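/- Let $k$ be an algebraically closed field of characteristic zero, $K=k((z))$, $n\ge 0$ an integer, and let $\partial_z$ be the formal derivative on $K$ (applied to matrices entrywise). Write $\operatorname{dlog} z=z^{-1}dz$. An *$\mathrm{SL}_n$-connection* is an expression $A\operatorname{dlog} z$ with $A\in\mathfrak{sl}_n(K)$. The group $\mathrm{SL}_n(K)$ acts on connections by $$g[A\operatorname{dlog} z]=\bigl(gAg^{-1}+z\partial_z(g)\,g^{-1}\bigr)\operatorname{dlog} z ;$$ two connections in the same orbit are called *gauge equivalent*. A connection is *regular* if it is gauge equivalent to some $A\operatorname{dlog} z$ with $A\in\mathfrak{sl}_n(k[[z]])$. For an integer $m\ge1$ the pull-back along $\iota_m:K\to K$, $f(z)\mapsto f(z^m)$, is $\iota_m(A(z)\operatorname{dlog} z)=mA(z^m)\operatorname{dlog} z$. Two connections $A,B$ are *related* if $\iota_m(A)$ and $\iota_m(B)$ are gauge equivalent for some integer $m\ge1$; this is an equivalence relation. Let $J(x,a)$ be the $a\times a$ Jordan block with diagonal entries $x\in k$ and superdiagonal entries $1$ ($a\geq 1$), and let $\mathcal J(\mathfrak{sl}_n)$ be the set of trace-zero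 matrices $\operatorname{blockdiag}(J(x_1,a_1),\dots,J(x_r,a_r))$ of size $n\times n$ over $k$. Two such matrices $\operatorname{blockdiag}(J(x_1,a_1),\dots,J(x_r,a_r))$ and $\operatorname{blockdiag}(J(y_1,b_1),\dots,J(y_s,b_s))$ *differ rationally after block permutation* if $r=s$ and there is a permutation $\tau$ of $\{1,\dots,r\}$ with $a_i=b_{\tau(i)}$ and $x_i-y_{\tau(i)}\in\mathbb Q$ for all $i$. **Theorem.** The map $X\mapsto X\operatorname{dlog} z$ induces a surjection $$\mathcal J(\mathfrak{sl}_n)\twoheadrightarrow\{\text{regular }\mathrm{SL}_n\text{-connections}\}/\text{relationship}.$$ For $X,Y\in\mathcal J(\mathfrak{sl}_n)$, the connections $X\operatorname{dlog} z$ and $Y\operatorname{dlog} z$ are related if and only if $X$ and $Y$ differ rationally after block permutation. -/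

import Mathlib

open scoped LaurentSeries PowerSeries

namespace RegConn

noncomputable section

section Field

variable {k : Type*} [Field k]

/-- The derivation `z ∂_z` of the field `K = k((z))` of Laurent series. -/
def theta (f : k⸨X⸩) : k⸨X⸩ :=
  HahnSeries.single 1 1 * LaurentSeries.derivative k f

theorem theta_coeff (f : k⸨X⸩) (i : ℤ) : (theta f).coeff i = (i : k) * f.coeff i := by
  have h := HahnSeries.coeff_single_mul_add (r := (1 : k)) (x := LaurentSeries.derivative k f)
    (a := i - 1) (b := 1)
  rw [sub_add_cancel, LaurentSeries.derivative_apply, LaurentSeries.hasseDeriv_coeff] at h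
  rw [theta, LaurentSeries.derivative_apply, h]
  simp

theorem theta_add (f g : k⸨X⸩) : theta (f + g) = theta f + theta g := by
  ext i; simp [theta_coeff, mul_add]

theorem theta_sum {ι : Type*} (s : Finset ι) (f : ι → k⸨X⸩) :
    theta (∑ i ∈ s, f i) = ∑ i ∈ s, theta (f i) := by
  classical
  refine map_sum (AddMonoidHom.mk' theta theta_add) f s

theorem theta_mul (f g : k⸨X⸩) : theta (f * g) = theta f * g + f * theta g := by
  have hs : ∀ h : k⸨X⸩, (theta h).support ⊆ h.support := by
    intro h i hi hz
    exact hi (by simp [theta_coeff, hz])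
  ext i
  rw [theta_coeff, HahnSeries.coeff_add, HahnSeries.coeff_mul,
    HahnSeries.coeff_mul_left' f.isPWO_support (hs f),
    HahnSeries.coeff_mul_right' g.isPWO_support (hs g), Finset.mul_sum,
    ← Finset.sum_add_distrib]
  refine Finset.sum_congr rfl fun p hp => ?_
  rw [Finset.mem_antidiagonal] at hp
  rw [theta_coeff, theta_coeff, ← hp.2.2]
  push_cast
  ring

theorem theta_zero : theta (0 : k⸨X⸩) = 0 := by
  ext i; simp [theta_coeff]

theorem theta_one : theta (1 : k⸨X⸩) = 0 := by
  have h := theta_mul (1 : k⸨X⸩) 1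
  simpa using h

/-- The field extension `ι_m : K → K`, `f(z) ↦ f(z ^ m)`, for a positive integer `m`. -/
def iota (m : ℕ+) : k⸨X⸩ →+* k⸨X⸩ :=
  HahnSeries.embDomainRingHom (AddMonoidHom.mulLeft (m : ℤ))
    (fun a b h => by
      have hm : (m : ℤ) ≠ 0 := by exact_mod_cast m.ne_zero
      exact mul_left_cancel₀ hm h)
    (fun a b => by
      have hm : (0 : ℤ) < m := by exact_mod_cast m.pos
      exact mul_le_mul_iff_right₀ hm)

theorem iota_coeff_mul (m : ℕ+) (f : k⸨X⸩) (i : ℤ) :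
    (iota m f).coeff ((m : ℤ) * i) = f.coeff i := by
  exact HahnSeries.embDomain_coeff (a := i)

theorem iota_coeff_of_not_dvd (m : ℕ+) (f : k⸨X⸩) (i : ℤ) (h : ¬ (m : ℤ) ∣ i) :
    (iota m f).coeff i = 0 := by
  refine HahnSeries.embDomain_of_notMem_range ?_
  rintro ⟨j, rfl⟩
  exact h ⟨j, rfl⟩

theorem theta_iota (m : ℕ+) (f : k⸨X⸩) :
    theta (iota m f) = (m : k⸨X⸩) * iota m (theta f) := by
  have hC : ((m : ℕ) : k⸨X⸩) = HahnSeries.C ((m : ℕ) : k) := by simp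
  ext i
  rw [hC, theta_coeff, HahnSeries.C_mul_eq_smul, HahnSeries.coeff_smul, smul_eq_mul]
  by_cases h : (m : ℤ) ∣ i
  · obtain ⟨j, rfl⟩ := h
    rw [iota_coeff_mul, iota_coeff_mul, theta_coeff]
    push_cast
    ring
  · rw [iota_coeff_of_not_dvd _ _ _ h, iota_coeff_of_not_dvd _ _ _ h]
    simp

theorem iota_iota (l m : ℕ+) (f : k⸨X⸩) : iota l (iota m f) = iota (l * m) f := by
  ext i
  by_cases h : ((l * m : ℕ+) : ℤ) ∣ i
  · obtain ⟨j, rfl⟩ := h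
    rw [iota_coeff_mul]
    rw [show ((l * m : ℕ+) : ℤ) * j = (l : ℤ) * ((m : ℤ) * j) by push_cast; ring,
      iota_coeff_mul, iota_coeff_mul]
  · rw [iota_coeff_of_not_dvd _ _ _ h]
    by_cases h1 : (l : ℤ) ∣ i
    · obtain ⟨j, rfl⟩ := h1
      rw [iota_coeff_mul, iota_coeff_of_not_dvd]
      rintro ⟨a, rfl⟩
      exact h ⟨a, by push_cast; ring⟩
    · rw [iota_coeff_of_not_dvd _ _ _ h1]

end Field

/-- An `SL_n`-connection `A dlog z` (where `dlog z = z⁻¹ dz`) on the infinitesimal punctured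
disc, given by its coefficient `A ∈ 𝔰𝔩_n(K)`, `K = k((z))`. -/
@[ext]
structure SLConnection (n : ℕ) (k : Type*) [Field k] where
  /-- The coefficient with respect to `dlog z`. -/
  coeff : LieAlgebra.SpecialLinear.sl (Fin n) k⸨X⸩

variable {n : ℕ} {k : Type*} [Field k]

theorem mem_sl_iff {R : Type*} [CommRing R] (A : Matrix (Fin n) (Fin n) R) :
    A ∈ LieAlgebra.SpecialLinear.sl (Fin n) R ↔ A.trace = 0 := Iff.rfl

/-- The coefficient of `g[A dlog z] = (g A g⁻¹ + z∂_z(g) g⁻¹) dlog z`. -/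
def gaugeCoeff (g : Matrix.SpecialLinearGroup (Fin n) k⸨X⸩)
    (A : Matrix (Fin n) (Fin n) k⸨X⸩) : Matrix (Fin n) (Fin n) k⸨X⸩ :=
  g.1 * A * (g⁻¹).1 + g.1.map theta * (g⁻¹).1

/-- Gauge equivalence: there is `g ∈ SL_n(K)` with `g[A] = B`. -/
def GaugeEquiv (A B : SLConnection n k) : Prop :=
  ∃ g : Matrix.SpecialLinearGroup (Fin n) k⸨X⸩, gaugeCoeff g A.coeff.1 = B.coeff.1

/-- Connections of the first kind: those in `𝔰𝔩_n[[z]] dlog z`. -/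
def IsFirstKind (A : SLConnection n k) : Prop :=
  ∀ i j, ∃ f : k⟦X⟧, A.coeff.1 i j = (f : k⸨X⸩)

/-- A connection is regular if it is gauge equivalent to a connection of the first kind. -/
def IsRegular (A : SLConnection n k) : Prop :=
  ∃ B : SLConnection n k, IsFirstKind B ∧ GaugeEquiv A B

/-- The pull-back `ι_m(A(z) dlog z) = m A(z ^ m) dlog z`. -/
def pullback (m : ℕ+) (A : SLConnection n k) : SLConnection n k where
  coeff := ⟨(m : k⸨X⸩) • A.coeff.1.map (iota m), by
    have h : A.coeff.1.trace = 0 := A.coeff.2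
    rw [mem_sl_iff, Matrix.trace_smul]
    have : (A.coeff.1.map (iota m)).trace = iota m A.coeff.1.trace := by
      simp [Matrix.trace]
    rw [this, h, map_zero, smul_zero]⟩

/-- Two connections are related if some pull-backs `ι_m(A)` and `ι_m(B)` are gauge
equivalent. -/
def Related (A B : SLConnection n k) : Prop :=
  ∃ m : ℕ+, GaugeEquiv (pullback m A) (pullback m B)

theorem map_theta_mul (g h : Matrix (Fin n) (Fin n) k⸨X⸩) :
    (g * h).map theta = g.map theta * h + g * h.map theta := by
  ext1 i j
  simp [Matrix.mul_apply, theta_sum, theta_mul, Finset.sum_add_distrib]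

theorem map_theta_one : (1 : Matrix (Fin n) (Fin n) k⸨X⸩).map theta = 0 := by
  ext1 i j
  by_cases h : i = j
  · subst h; simp [theta_one]
  · simp [Matrix.one_apply_ne h, theta_zero]

theorem gaugeCoeff_one (A : Matrix (Fin n) (Fin n) k⸨X⸩) : gaugeCoeff 1 A = A := by
  simp [gaugeCoeff, map_theta_one]

theorem gaugeCoeff_mul (g h : Matrix.SpecialLinearGroup (Fin n) k⸨X⸩)
    (A : Matrix (Fin n) (Fin n) k⸨X⸩) :
    gaugeCoeff (g * h) A = gaugeCoeff g (gaugeCoeff h A) := by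
  have e : h.1 * (h⁻¹).1 = 1 := by
    rw [← Matrix.SpecialLinearGroup.coe_mul, mul_inv_cancel, Matrix.SpecialLinearGroup.coe_one]
  have e3 : g.1.map theta * h.1 * ((h⁻¹).1 * (g⁻¹).1) = g.1.map theta * (g⁻¹).1 := by
    rw [mul_assoc, ← mul_assoc h.1, e, one_mul]
  simp only [gaugeCoeff, mul_inv_rev, Matrix.SpecialLinearGroup.coe_mul, map_theta_mul, add_mul,
    e3]
  noncomm_ring

theorem GaugeEquiv.refl (A : SLConnection n k) : GaugeEquiv A A := ⟨1, gaugeCoeff_one _⟩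

theorem GaugeEquiv.symm {A B : SLConnection n k} (h : GaugeEquiv A B) : GaugeEquiv B A := by
  obtain ⟨g, hg⟩ := h
  exact ⟨g⁻¹, by rw [← hg, ← gaugeCoeff_mul, inv_mul_cancel, gaugeCoeff_one]⟩

theorem GaugeEquiv.trans {A B C : SLConnection n k} (h : GaugeEquiv A B) (h' : GaugeEquiv B C) :
    GaugeEquiv A C := by
  obtain ⟨g, hg⟩ := h
  obtain ⟨g', hg'⟩ := h'
  exact ⟨g' * g, by rw [gaugeCoeff_mul, hg, hg']⟩

theorem GaugeEquiv.pullback {A B : SLConnection n k} (h : GaugeEquiv A B) (m : ℕ+) :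
    GaugeEquiv (pullback m A) (pullback m B) := by
  obtain ⟨g, hg⟩ := h
  refine ⟨Matrix.SpecialLinearGroup.map (iota m) g, ?_⟩
  have e1 : (Matrix.SpecialLinearGroup.map (iota m) g).1 = g.1.map (iota m) := rfl
  have e2 : ((Matrix.SpecialLinearGroup.map (iota m) g)⁻¹).1 = (g⁻¹).1.map (iota m) := by
    rw [← map_inv]; rfl
  have e3 : (g.1.map (iota m)).map theta = (m : k⸨X⸩) • (g.1.map theta).map (iota m) := by
    ext1 i j
    simp [theta_iota]
  simp only [gaugeCoeff, RegConn.pullback, e1, e2, e3]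
  rw [← hg, gaugeCoeff, Matrix.map_add _ (map_add (iota m)), Matrix.map_mul, Matrix.map_mul,
    Matrix.map_mul, smul_add, Matrix.mul_smul, Matrix.smul_mul, Matrix.smul_mul]

theorem pullback_pullback (l m : ℕ+) (A : SLConnection n k) :
    pullback l (pullback m A) = pullback (l * m) A := by
  ext i j
  simp [pullback, iota_iota, mul_assoc]

theorem related_equivalence : Equivalence (Related (n := n) (k := k)) where
  refl A := ⟨1, GaugeEquiv.refl _⟩
  symm := fun ⟨m, h⟩ => ⟨m, h.symm⟩
  trans := by
    rintro A B C ⟨l, h⟩ ⟨m, h'⟩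
    refine ⟨m * l, ?_⟩
    have h1 := h.pullback m
    have h2 := h'.pullback l
    rw [pullback_pullback, pullback_pullback] at h1 h2
    rw [mul_comm l m] at h2
    exact h1.trans h2

/-- The connection `X dlog z` for a constant matrix `X ∈ 𝔰𝔩_n(k)`. -/
def standard (X : LieAlgebra.SpecialLinear.sl (Fin n) k) : SLConnection n k where
  coeff := ⟨X.1.map HahnSeries.C, by
    have h : X.1.trace = 0 := X.2
    have : (X.1.map (HahnSeries.C : k →+* k⸨X⸩)).trace = HahnSeries.C X.1.trace := by
      simp [Matrix.trace]
    rw [mem_sl_iff, this, h, map_zero]⟩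

theorem isRegular_standard (X : LieAlgebra.SpecialLinear.sl (Fin n) k) :
    IsRegular (standard X) :=
  ⟨_, fun i j => ⟨PowerSeries.C (X.1 i j), by simp [standard]⟩, GaugeEquiv.refl _⟩

variable (n k) in
/-- The set of regular `SL_n`-connections. -/
abbrev RegularConnection : Type _ := {A : SLConnection n k // IsRegular A}

variable (n k) in
/-- The relationship relation on regular `SL_n`-connections. -/
def relationship : Setoid (RegularConnection n k) :=
  Setoid.comap Subtype.val ⟨Related, related_equivalence⟩

/-- The Jordan block `J(x, a)`, with `x` on the diagonal and `1` on the superdiagonal. -/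
def jordanBlock (x : k) (a : ℕ) : Matrix (Fin a) (Fin a) k :=
  Matrix.of fun i j => if i = j then x else if (i : ℕ) + 1 = j then 1 else 0

variable (n k) in
/-- An ordered list of Jordan blocks `J(x_1, a_1), …, J(x_r, a_r)` of total size `n`. -/
structure JordanData where
  /-- The number of blocks. -/
  r : ℕ
  /-- The eigenvalues. -/
  x : Fin r → k
  /-- The sizes. -/
  a : Fin r → ℕ
  a_pos : ∀ i, 0 < a i
  sum_a : ∑ i, a i = n

/-- The block diagonal matrix `blockdiag(J(x_1, a_1), …, J(x_r, a_r))`. -/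
def JordanData.toMatrix (D : JordanData n k) : Matrix (Fin n) (Fin n) k :=
  Matrix.reindex (finSigmaFinEquiv.trans (finCongr D.sum_a))
    (finSigmaFinEquiv.trans (finCongr D.sum_a))
    (Matrix.blockDiagonal' fun i => jordanBlock (D.x i) (D.a i))

/-- Matrices in Jordan normal form. -/
def IsJordan (X : Matrix (Fin n) (Fin n) k) : Prop :=
  ∃ D : JordanData n k, D.toMatrix = X

variable (n k) in
/-- The matrices in Jordan normal form in `𝔰𝔩_n(k)`. -/
abbrev JordanSl : Type _ := {X : LieAlgebra.SpecialLinear.sl (Fin n) k // IsJordan X.1}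

/-- `X` and `Y` (in Jordan normal form) differ rationally after block permutation: there is a
bijection between their Jordan blocks that preserves the sizes and changes the eigenvalues by
rational numbers. -/
def DifferRationally [CharZero k] (X Y : Matrix (Fin n) (Fin n) k) : Prop :=
  ∃ D E : JordanData n k, D.toMatrix = X ∧ E.toMatrix = Y ∧
    ∃ τ : Fin D.r ≃ Fin E.r, ∀ i, D.a i = E.a (τ i) ∧ ∃ q : ℚ, D.x i - E.x (τ i) = (q : k)

variable (n k) in
/-- The map `X ↦ [X dlog z]` from Jordan matrices in `𝔰𝔩_n(k)` to relationship classes of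
regular `SL_n`-connections. -/
def jordanClass (X : JordanSl n k) : Quotient (relationship n k) :=
  Quotient.mk (relationship n k) ⟨standard X.1, isRegular_standard X.1⟩

end

end RegConn

namespace RegConn

noncomputable section

/-! ### Logarithmic derivatives and gauge equivalence under `GL_n`. -/

section Field

variable {k : Type*} [Field k]

/-! Between trace-zero matrices, `GL_n(K)`-gauge equivalence is no weaker than `SL_n(K)`-gauge
equivalence: the determinant of the gauge is a constant and can be scaled to 1 by an `n`-th root in
`k` (`GLGauge.gaugeEquiv`). So one may work with `GLGauge`.

Surjectivity: a connection of the first kind has a formal eigenvector, which splits off a block of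
size one (`exists_split_block`). By induction on `n` it becomes a constant matrix whose eigenvalues
represent distinct cosets of ℤ whenever they are distinct; this non-resonance lets the remaining
off-diagonal row be solved coefficient by coefficient (`exists_reduce_row`). Jordan form follows. A
diagonal gauge `z^d`, with `d` constant on blocks, shifts eigenvalues by integers, and after
pull-back it realises rational shifts (`GLGauge.withX`). This restores trace zero and also shows
that matrices which differ rationally give related connections.

Conversely, `dim ker (z∂_z - A + l)^j` is a gauge invariant. For `A = mX` with `X` Jordan it equals
the sum of `min j a_b` over the blocks with `m x_b ∈ l + ℤ` (`JordanData.finrank_ker_jordanOp`).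
Second differences in `j` count the blocks of each size in each class modulo ℤ, so the blocks of `X`
and `Y` can be matched. -/

theorem theta_C (c : k) : theta (HahnSeries.C c : k⸨X⸩) = 0 := by
  ext i
  rw [theta_coeff, HahnSeries.coeff_zero]
  by_cases h : i = 0
  · simp [h]
  · simp [HahnSeries.coeff_single_of_ne h]

theorem theta_single (t : ℤ) (c : k) :
    theta (HahnSeries.single t c : k⸨X⸩) = (t : k⸨X⸩) * HahnSeries.single t c := by
  have hC : (t : k⸨X⸩) = HahnSeries.C (t : k) := by simp
  ext i
  rw [theta_coeff, hC, HahnSeries.C_mul_eq_smul, HahnSeries.coeff_smul, smul_eq_mul]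
  by_cases h : i = t
  · simp [h]
  · simp [HahnSeries.coeff_single_of_ne h]

theorem isUnit_single_one (t : ℤ) : IsUnit (HahnSeries.single t (1 : k) : k⸨X⸩) :=
  isUnit_iff_ne_zero.2 (by simp)

/-- The ring homomorphism `f ↦ f + ε z∂_z f` to the dual numbers over `K`. -/
def thetaDual : k⸨X⸩ →+* DualNumber k⸨X⸩ where
  toFun f := TrivSqZeroExt.inl f + TrivSqZeroExt.inr (theta f)
  map_one' := by simp [theta_one]
  map_zero' := by simp [theta_zero]
  map_add' f g := by ext <;> simp [theta_add]
  map_mul' f g := by ext <;> simp [theta_mul, mul_comm, add_comm]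

variable {ι : Type*} [Fintype ι] [DecidableEq ι]

/-- Since `ε² = 0`, the determinant expansion stops at the trace term. -/
theorem det_one_add_eps_smul (A : Matrix ι ι k⸨X⸩) :
    (1 + (DualNumber.eps : DualNumber k⸨X⸩) • A.map (TrivSqZeroExt.inlHom k⸨X⸩ k⸨X⸩)).det =
      1 + TrivSqZeroExt.inr A.trace := by
  rw [Matrix.det_one_add_smul, pow_two, DualNumber.eps_mul_eps, mul_zero, add_zero]
  have : (A.map (TrivSqZeroExt.inlHom k⸨X⸩ k⸨X⸩)).trace = TrivSqZeroExt.inl A.trace := by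
    have := (AddMonoidHom.map_trace (TrivSqZeroExt.inlHom k⸨X⸩ k⸨X⸩) A).symm
    simpa using this
  rw [this]
  ext <;> simp

/-- The logarithmic derivative of the determinant is the trace. -/
theorem theta_det {g A B : Matrix ι ι k⸨X⸩} (h : g.map theta = B * g - g * A) :
    theta g.det = (B.trace - A.trace) * g.det := by
  set φ := TrivSqZeroExt.inlHom k⸨X⸩ k⸨X⸩
  -- The gauge equation becomes a multiplicative identity over the dual numbers; the `ε`-part of its
  -- determinant is the claim.
  have e : g.map thetaDual * (1 + (DualNumber.eps : DualNumber k⸨X⸩) • A.map φ) =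
      (1 + (DualNumber.eps : DualNumber k⸨X⸩) • B.map φ) * g.map φ := by
    have h1 : g.map thetaDual = g.map φ + (DualNumber.eps : DualNumber k⸨X⸩) •
        (B * g - g * A).map φ := by
      rw [← h]
      ext i j <;> simp [thetaDual, φ]
    rw [h1, Matrix.map_sub _ (map_sub φ), Matrix.map_mul, Matrix.map_mul]
    simp only [add_mul, sub_mul, mul_add, mul_one, one_mul, Matrix.smul_mul, Matrix.mul_smul, smul_smul,
      DualNumber.eps_mul_eps, zero_smul, smul_sub, add_zero, sub_zero]
    abel
  have d := congrArg Matrix.det e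
  rw [Matrix.det_mul, Matrix.det_mul, det_one_add_eps_smul, det_one_add_eps_smul,
    ← RingHom.mapMatrix_apply, ← RingHom.mapMatrix_apply, ← RingHom.map_det, ← RingHom.map_det] at d
  have s := congrArg TrivSqZeroExt.snd d
  simp [thetaDual, φ] at s
  linear_combination s

/-- Gauge equivalence under the general linear group: `g[A] = B` for an invertible `g`. -/
def GLGauge (A B : Matrix ι ι k⸨X⸩) : Prop :=
  ∃ g : Matrix ι ι k⸨X⸩, IsUnit g ∧ g.map theta = B * g - g * A

omit [DecidableEq ι] in
theorem map_theta_mul' (g h : Matrix ι ι k⸨X⸩) :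
    (g * h).map theta = g.map theta * h + g * h.map theta := by
  ext1 i j
  simp [Matrix.mul_apply, theta_sum, theta_mul, Finset.sum_add_distrib]

omit [Fintype ι] in
theorem map_theta_one' : (1 : Matrix ι ι k⸨X⸩).map theta = 0 := by
  ext1 i j
  by_cases h : i = j
  · subst h; simp [theta_one]
  · simp [Matrix.one_apply_ne h, theta_zero]

theorem GLGauge.refl (A : Matrix ι ι k⸨X⸩) : GLGauge A A :=
  ⟨1, isUnit_one, by rw [map_theta_one', mul_one, one_mul, sub_self]⟩

theorem GLGauge.trans {A B C : Matrix ι ι k⸨X⸩} (h : GLGauge A B) (h' : GLGauge B C) :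
    GLGauge A C := by
  obtain ⟨g, u, hg⟩ := h
  obtain ⟨g', u', hg'⟩ := h'
  refine ⟨g' * g, u'.mul u, ?_⟩
  rw [map_theta_mul', hg, hg']
  noncomm_ring

theorem GLGauge.symm {A B : Matrix ι ι k⸨X⸩} (h : GLGauge A B) : GLGauge B A := by
  obtain ⟨g, u, hg⟩ := h
  obtain ⟨u, rfl⟩ := u
  refine ⟨(u⁻¹ : (Matrix ι ι k⸨X⸩)ˣ), Units.isUnit _, ?_⟩
  have h1 := map_theta_mul' (u : Matrix ι ι k⸨X⸩) ((u⁻¹ : (Matrix ι ι k⸨X⸩)ˣ))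
  rw [Units.mul_inv, map_theta_one', hg] at h1
  refine u.isUnit.mul_left_cancel ?_
  have h2 : (u : Matrix ι ι k⸨X⸩) * ((u⁻¹ : (Matrix ι ι k⸨X⸩)ˣ) : Matrix ι ι k⸨X⸩).map theta =
    -((B * u - u * A) * ((u⁻¹ : (Matrix ι ι k⸨X⸩)ˣ) : Matrix ι ι k⸨X⸩)) :=
    eq_neg_of_add_eq_zero_right h1.symm
  rw [h2, sub_mul, mul_assoc B, Units.mul_inv, mul_sub, ← mul_assoc, ← mul_assoc, Units.mul_inv,
    mul_one, one_mul, neg_sub]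

theorem GLGauge.submatrix {ι' : Type*} [Fintype ι'] [DecidableEq ι'] {A B : Matrix ι ι k⸨X⸩}
    (h : GLGauge A B) (e : ι' ≃ ι) : GLGauge (A.submatrix e e) (B.submatrix e e) := by
  obtain ⟨g, u, hg⟩ := h
  refine ⟨g.submatrix e e, (Matrix.isUnit_submatrix_equiv e e).2 u, ?_⟩
  rw [Matrix.submatrix_mul_equiv, Matrix.submatrix_mul_equiv, ← Matrix.submatrix_map, hg]
  rfl

theorem GLGauge.of_const {A B P : Matrix ι ι k} (hP : IsUnit P) (h : P * A = B * P) :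
    GLGauge (A.map (HahnSeries.C : k →+* k⸨X⸩)) (B.map (HahnSeries.C : k →+* k⸨X⸩)) := by
  refine ⟨P.map (HahnSeries.C : k →+* k⸨X⸩), ?_, ?_⟩
  · rw [← RingHom.mapMatrix_apply]
    exact hP.map _
  · rw [← Matrix.map_mul, ← Matrix.map_mul, h, sub_self]
    ext1 i j
    exact theta_C _

/-- Gauge transformation by a diagonal matrix of powers of `z` that commutes with `A`. -/
theorem GLGauge.twist {A : Matrix ι ι k⸨X⸩} (d : ι → ℤ)
    (h : ∀ i j, A i j ≠ 0 → d i = d j) :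
    GLGauge A (A + Matrix.diagonal fun i => (d i : k⸨X⸩)) := by
  refine ⟨Matrix.diagonal fun i => HahnSeries.single (d i) 1, ?_, ?_⟩
  · rw [Matrix.isUnit_diagonal, Pi.isUnit_iff]
    exact fun i => isUnit_single_one _
  · ext1 i j
    rw [Matrix.sub_apply, Matrix.mul_diagonal, Matrix.diagonal_mul, Matrix.map_apply,
      Matrix.add_apply]
    by_cases hij : i = j
    · subst hij
      simp only [Matrix.diagonal_apply_eq, theta_single]
      ring
    · rw [Matrix.diagonal_apply_ne _ hij, Matrix.diagonal_apply_ne _ hij, theta_zero]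
      by_cases hA : A i j = 0
      · simp [hA]
      · rw [h i j hA]
        ring

theorem GLGauge.iota_map {A B : Matrix ι ι k⸨X⸩} (h : GLGauge A B) (m : ℕ+) :
    GLGauge ((m : k⸨X⸩) • A.map (iota m)) ((m : k⸨X⸩) • B.map (iota m)) := by
  obtain ⟨g, u, hg⟩ := h
  refine ⟨g.map (iota m), ?_, ?_⟩
  · rw [← RingHom.mapMatrix_apply]
    exact u.map _
  · have : (g.map (iota m)).map theta = (m : k⸨X⸩) • (g.map theta).map (iota m) := by
      ext1 i j
      simp [theta_iota]
    rw [this, hg, Matrix.map_sub _ (map_sub (iota m)), Matrix.map_mul, Matrix.map_mul, smul_sub,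
      Matrix.smul_mul, Matrix.mul_smul]

theorem eq_C_of_theta_eq_zero [CharZero k] {f : k⸨X⸩} (h : theta f = 0) :
    f = HahnSeries.C (f.coeff 0) := by
  ext i
  by_cases hi : i = 0
  · simp [hi]
  · have := congrArg (fun g => g.coeff i) h
    simp only [theta_coeff, HahnSeries.coeff_zero, mul_eq_zero, Int.cast_eq_zero, hi,
      false_or] at this
    rw [this]
    simp [HahnSeries.coeff_single_of_ne hi]

/-- Comparing coefficients gives `i f_i = c f_i`, so any exponent in the support of `f` equals `c`.
-/
theorem exists_int_of_theta_eq {f : k⸨X⸩} (hf : f ≠ 0) {c : k}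
    (h : theta f = HahnSeries.C c * f) : ∃ t : ℤ, c = t := by
  obtain ⟨i, hi⟩ : ∃ i, f.coeff i ≠ 0 := by
    by_contra! H
    exact hf (HahnSeries.ext (funext H))
  refine ⟨i, ?_⟩
  have := congrArg (fun g => g.coeff i) h
  simp only [theta_coeff, HahnSeries.C_mul_eq_smul, HahnSeries.coeff_smul, smul_eq_mul] at this
  exact (mul_right_cancel₀ hi this).symm

end Field

/-! ### Comparison of `SL_n`- and `GL_n`-gauge equivalence. -/

variable {n : ℕ} {k : Type*} [Field k]

theorem GaugeEquiv.glGauge {A B : SLConnection n k} (h : GaugeEquiv A B) :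
    GLGauge A.coeff.1 B.coeff.1 := by
  obtain ⟨g, hg⟩ := h
  have e : (g⁻¹).1 * g.1 = 1 := by
    rw [← Matrix.SpecialLinearGroup.coe_mul, inv_mul_cancel, Matrix.SpecialLinearGroup.coe_one]
  refine ⟨g.1, ?_, ?_⟩
  · rw [Matrix.isUnit_iff_isUnit_det, g.2]
    exact isUnit_one
  · rw [← hg, gaugeCoeff, add_mul, mul_assoc, mul_assoc _ _ g.1, e]
    simp

/-- Both traces vanish, so `z∂_z` kills `det g`, which is then a constant `c`. Scaling `g` by a
constant `s` with `s ^ n * c = 1` keeps the gauge equation. -/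
theorem GLGauge.gaugeEquiv [IsAlgClosed k] [CharZero k] {A B : SLConnection n k}
    (h : GLGauge A.coeff.1 B.coeff.1) : GaugeEquiv A B := by
  obtain ⟨g, u, hg⟩ := h
  have hd := theta_det hg
  rw [(mem_sl_iff _).1 A.coeff.2, (mem_sl_iff _).1 B.coeff.2, sub_self, zero_mul] at hd
  have hc := eq_C_of_theta_eq_zero hd
  set c := g.det.coeff 0
  have hc0 : c ≠ 0 := by
    rintro h0
    rw [h0, map_zero] at hc
    rw [Matrix.isUnit_iff_isUnit_det, hc] at u
    exact not_isUnit_zero u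
  obtain ⟨s, hs⟩ : ∃ s : k, s ^ n * c = 1 := by
    -- For `n = 0` no root is available, but the empty determinant already forces `c = 1`.
    rcases Nat.eq_zero_or_pos n with rfl | hn
    · refine ⟨1, ?_⟩
      have : (HahnSeries.C c : k⸨X⸩) = HahnSeries.C 1 := by
        rw [← hc, map_one, Matrix.det_isEmpty]
      rw [HahnSeries.C_injective this]
      simp
    · obtain ⟨s, hs⟩ := IsAlgClosed.exists_pow_nat_eq c⁻¹ hn
      exact ⟨s, by rw [hs, inv_mul_cancel₀ hc0]⟩
  let g' : Matrix.SpecialLinearGroup (Fin n) k⸨X⸩ := ⟨(HahnSeries.C s : k⸨X⸩) • g, by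
    rw [Matrix.det_smul, hc, Fintype.card_fin, ← map_pow, ← map_mul, hs, map_one]⟩
  have hg' : g'.1.map theta = B.coeff.1 * g'.1 - g'.1 * A.coeff.1 := by
    have : g'.1.map theta = (HahnSeries.C s : k⸨X⸩) • g.map theta := by
      ext1 i j
      simp only [g', Matrix.map_apply, Matrix.smul_apply, smul_eq_mul, theta_mul, theta_C, zero_mul,
        zero_add]
    rw [this, hg, smul_sub, Matrix.mul_smul, Matrix.smul_mul]
  refine ⟨g', ?_⟩
  have e : g'.1 * (g'⁻¹).1 = 1 := by
    rw [← Matrix.SpecialLinearGroup.coe_mul, mul_inv_cancel, Matrix.SpecialLinearGroup.coe_one]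
  rw [gaugeCoeff, hg', sub_mul, add_sub_cancel, mul_assoc, e, mul_one]


/-! ### Reduction of connections of the first kind to constant ones. -/

section Field

theorem exists_strong_recursion {α : Type*} (F : ∀ n : ℕ, (∀ m < n, α) → α) :
    ∃ v : ℕ → α, ∀ n, v n = F n fun m _ => v m :=
  ⟨WellFounded.fix Nat.lt_wfRel.wf F, fun n => WellFounded.fix_eq _ F n⟩

/-- The restriction of `z ∂_z` to formal power series. -/
def thetaPS (f : k⟦X⟧) : k⟦X⟧ := PowerSeries.mk fun n => (n : k) * PowerSeries.coeff n f

theorem ofPowerSeries_coeff (f : k⟦X⟧) (i : ℤ) :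
    (HahnSeries.ofPowerSeries ℤ k f).coeff i =
      if i < 0 then 0 else PowerSeries.coeff i.natAbs f :=
  PowerSeries.coeff_coe f i

theorem theta_ofPowerSeries (f : k⟦X⟧) :
    theta (HahnSeries.ofPowerSeries ℤ k f) = HahnSeries.ofPowerSeries ℤ k (thetaPS f) := by
  ext i
  rw [theta_coeff, ofPowerSeries_coeff, ofPowerSeries_coeff]
  split_ifs with h
  · simp
  · obtain ⟨m, rfl⟩ := Int.eq_ofNat_of_zero_le (not_lt.1 h)
    simp [thetaPS]

/-- Only finitely many `l₀ + i` with `i ∈ ℕ` are eigenvalues; the last one has no eigenvalue above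
it in its coset, which removes the obstructions to a power series solution. -/
theorem exists_maximal_eigenvalue [IsAlgClosed k] [CharZero k] {ι : Type*} [Fintype ι]
    [DecidableEq ι] [Nonempty ι] (M : Matrix ι ι k) :
    ∃ l : k, (Matrix.scalar ι l - M).det = 0 ∧
      ∀ i : ℕ, i ≠ 0 → (Matrix.scalar ι (i + l) - M).det ≠ 0 := by
  have hdeg : M.charpoly.degree ≠ 0 := by
    rw [Matrix.charpoly_degree_eq_dim]
    exact_mod_cast Fintype.card_ne_zero
  obtain ⟨l₀, h₀⟩ := IsAlgClosed.exists_root M.charpoly hdeg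
  let S : Set ℕ := {i | M.charpoly.IsRoot (i + l₀)}
  have hfin : S.Finite := by
    refine Set.Finite.preimage (f := fun i : ℕ => (i : k) + l₀)
      (s := {x | M.charpoly.IsRoot x}) ?_ (Polynomial.finite_setOfPred_isRoot M.charpoly_monic.ne_zero)
    intro a _ b _ h
    simpa using h
  obtain ⟨i, hi, hmax⟩ := hfin.exists_maximal ⟨0, by simpa [S] using h₀⟩
  refine ⟨i + l₀, by rw [← Matrix.eval_charpoly]; exact hi, fun j hj h => ?_⟩
  rw [← Matrix.eval_charpoly, ← add_assoc] at h
  have : j + i ∈ S := by simpa [S] using h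
  have := hmax this (by omega)
  omega

/-- Isolates the top coefficient of `v`, so that the eigenvector equation becomes a recursion. -/
theorem coeff_mulVec {ι : Type*} [Fintype ι] (B : Matrix ι ι k⟦X⟧) (v : ι → k⟦X⟧) (i : ι) (n : ℕ) :
    PowerSeries.coeff n (B.mulVec v i) =
      ((B.map PowerSeries.constantCoeff).mulVec fun j => PowerSeries.coeff n (v j)) i +
      (∑ b ∈ Finset.range n, (B.map (PowerSeries.coeff (n - b))).mulVec
        fun j => PowerSeries.coeff b (v j)) i := by
  simp only [Matrix.mulVec, dotProduct, map_sum, PowerSeries.coeff_mul, Finset.sum_apply,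
    Matrix.map_apply]
  rw [Finset.sum_comm (s := Finset.range n), ← Finset.sum_add_distrib]
  refine Finset.sum_congr rfl fun j _ => ?_
  rw [← Finset.Nat.sum_antidiagonal_swap, Finset.Nat.sum_antidiagonal_eq_sum_range_succ_mk,
    Finset.sum_range_succ, add_comm]
  simp

/-- A regular connection has a formal eigenvector with nonzero constant term. -/
theorem exists_formal_eigenvector [IsAlgClosed k] [CharZero k] {ι : Type*} [Fintype ι]
    [DecidableEq ι] [Nonempty ι] (B : Matrix ι ι k⟦X⟧) :
    ∃ (l : k) (v : ι → k⟦X⟧), (∃ i, PowerSeries.constantCoeff (v i) ≠ 0) ∧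
      ∀ i, thetaPS (v i) = B.mulVec v i - PowerSeries.C l * v i := by
  set B₀ := B.map PowerSeries.constantCoeff
  obtain ⟨l, hl, hmax⟩ := exists_maximal_eigenvalue B₀
  obtain ⟨v₀, hv₀, hBv⟩ := Matrix.exists_mulVec_eq_zero_iff.2 hl
  -- The `n`-th coefficient of `z∂_z v = B v - l v` reads `(n + l - B₀) v_n = ∑_{b<n} B_{n-b} v_b`.
  -- Maximality of `l` makes the left factor invertible for `n > 0`.
  obtain ⟨w, hw⟩ := exists_strong_recursion (α := ι → k) fun n f =>
    if n = 0 then v₀ else (Matrix.scalar ι (n + l) - B₀)⁻¹.mulVec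
      (∑ b : Fin n, (B.map (PowerSeries.coeff (n - b))).mulVec (f b b.2))
  refine ⟨l, fun i => PowerSeries.mk fun n => w n i, ?_, fun i => ?_⟩
  · obtain ⟨i, hi⟩ := Function.ne_iff.1 hv₀
    refine ⟨i, ?_⟩
    rw [← PowerSeries.coeff_zero_eq_constantCoeff_apply, PowerSeries.coeff_mk, hw 0, if_pos rfl]
    exact hi
  · ext n
    rw [map_sub, coeff_mulVec, PowerSeries.coeff_C_mul]
    simp only [thetaPS, PowerSeries.coeff_mk]
    have key : (Matrix.scalar ι (n + l) - B₀).mulVec (w n) =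
        ∑ b ∈ Finset.range n, (B.map (PowerSeries.coeff (n - b))).mulVec (w b) := by
      rcases Nat.eq_zero_or_pos n with rfl | hn
      · rw [hw 0, if_pos rfl]
        simpa using hBv
      · rw [hw n, if_neg hn.ne', Matrix.mulVec_mulVec, Matrix.mul_nonsing_inv _
          (isUnit_iff_ne_zero.2 (hmax n hn.ne')), Matrix.one_mulVec]
        exact Fin.sum_univ_eq_sum_range
          (fun b => (B.map (PowerSeries.coeff (n - b))).mulVec (w b)) n
    have := congrFun key i
    rw [Matrix.sub_mulVec, Pi.sub_apply, Matrix.scalar_apply, Matrix.mulVec_diagonal] at this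
    refine Eq.trans ?_ (congrArg (fun x => B₀.mulVec (w n) i + x - l * w n i) this)
    ring

variable (k) in
/-- A set of representatives for the cosets of `ℤ` in `k`. -/
def intReps : Set k :=
  Set.range (Quotient.out : k ⧸ (Int.castAddHom k).range → k)

theorem exists_sub_int_mem_intReps (l : k) : ∃ t : ℤ, l - t ∈ intReps k := by
  obtain ⟨t, ht⟩ := QuotientAddGroup.mk_out_eq_add (Int.castAddHom k).range l
  obtain ⟨s, hs⟩ := t.2
  refine ⟨-s, (QuotientAddGroup.mk l : k ⧸ (Int.castAddHom k).range), ?_⟩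
  rw [ht, ← hs]
  simp

theorem sub_int_notMem_intReps [CharZero k] {l : k} (h : l ∈ intReps k) {t : ℤ} (ht : t ≠ 0) :
    l - t ∉ intReps k := by
  rintro ⟨b, hb⟩
  obtain ⟨a, rfl⟩ := h
  have : a = b := by
    rw [← Quotient.out_eq a, ← Quotient.out_eq b]
    refine Quotient.sound ?_
    change QuotientAddGroup.leftRel _ _ _
    rw [QuotientAddGroup.leftRel_apply, hb]
    exact ⟨-t, by simp [sub_eq_add_neg]⟩
  rw [this, eq_comm, sub_eq_self] at hb
  exact ht (by exact_mod_cast hb)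

/-- Laurent series with prescribed coefficients that vanish wherever all coefficients of finitely
many given Laurent series do. -/
theorem exists_laurent_of_coeff {ι κ : Type*} [Finite ι] (r : ι → k⸨X⸩) (c : ℤ → κ → k)
    (h : ∀ i, (∀ j, (r j).coeff i = 0) → c i = 0) :
    ∃ u : κ → k⸨X⸩, ∀ i j, (u j).coeff i = c i j := by
  have hs : (⋃ j, (r j).support).IsPWO := by
    cases nonempty_fintype ι
    rw [← Set.biUnion_univ, ← Finset.coe_univ]
    exact (Finset.isPWO_bUnion Finset.univ).2 fun j _ => (r j).isPWO_support
  refine ⟨fun j => ⟨fun i => c i j, hs.mono fun i hi => ?_⟩, fun _ _ => rfl⟩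
  by_contra H
  simp only [Set.mem_iUnion, HahnSeries.mem_support, not_exists, not_not] at H
  exact hi (congrFun (h i H) j)

/-- In degree `i` the equation is `u_i (C - (m - i)) = r_i - δ_{i0} s`. For `i ≠ 0` the number `m -
i` is not a chosen representative, so the factor is invertible; in degree zero take `u_0 = 0` and
let `s` absorb `r_0`. -/
theorem exists_reduce_row [CharZero k] {ι : Type*} [Fintype ι] [DecidableEq ι]
    {C : Matrix ι ι k} (hC : ∀ c ∉ intReps k, IsUnit (C - Matrix.scalar ι c)) {m : k}
    (hm : m ∈ intReps k) (r : ι → k⸨X⸩) :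
    ∃ (u : ι → k⸨X⸩) (s : ι → k), ∀ j, theta (u j) = r j + HahnSeries.C m * u j -
      Matrix.vecMul u (C.map (HahnSeries.C : k →+* k⸨X⸩)) j - HahnSeries.C (s j) := by
  obtain ⟨u, hu⟩ := exists_laurent_of_coeff r (fun i => if i = 0 then 0 else
    Matrix.vecMul (fun j => (r j).coeff i) (C - Matrix.scalar ι (m - i))⁻¹) (by
      intro i hi
      have : (fun j => (r j).coeff i) = 0 := funext hi
      rw [this, Matrix.zero_vecMul, ite_self])
  refine ⟨u, fun j => (r j).coeff 0, fun j => ?_⟩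
  ext i
  have hv : (Matrix.vecMul u (C.map (HahnSeries.C : k →+* k⸨X⸩)) j).coeff i =
      Matrix.vecMul (fun j => (u j).coeff i) C j := by
    simp only [Matrix.vecMul, dotProduct, HahnSeries.coeff_sum, Matrix.map_apply]
    refine Finset.sum_congr rfl fun a _ => ?_
    rw [mul_comm, HahnSeries.C_mul_eq_smul, HahnSeries.coeff_smul, smul_eq_mul, mul_comm]
  rw [theta_coeff, HahnSeries.coeff_sub, HahnSeries.coeff_sub, HahnSeries.coeff_add, hv,
    HahnSeries.C_mul_eq_smul, HahnSeries.coeff_smul, smul_eq_mul]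
  by_cases hi : i = 0
  · subst hi
    have : (fun j => (u j).coeff 0) = 0 := funext fun j => by rw [hu, if_pos rfl]
    rw [this, Matrix.zero_vecMul, hu, if_pos rfl]
    simp
  · have hunit := hC _ (sub_int_notMem_intReps hm hi)
    have hui : (fun j => (u j).coeff i) = Matrix.vecMul (fun j => (r j).coeff i)
        (C - Matrix.scalar ι (m - i))⁻¹ := funext fun j => by rw [hu, if_neg hi]
    have key : Matrix.vecMul (fun j => (u j).coeff i) (C - Matrix.scalar ι (m - i)) =
        fun j => (r j).coeff i := by
      rw [hui, Matrix.vecMul_vecMul, Matrix.nonsing_inv_mul _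
        ((Matrix.isUnit_iff_isUnit_det _).1 hunit), Matrix.vecMul_one]
    have := congrFun key j
    rw [Matrix.vecMul_sub, Pi.sub_apply, Matrix.scalar_apply, Matrix.vecMul_diagonal] at this
    rw [← this, HahnSeries.C_apply, HahnSeries.coeff_single_of_ne hi]
    ring

theorem fromBlocks_sub {R ι κ : Type*} [AddGroup R] (A A' : Matrix ι ι R) (B B' : Matrix ι κ R)
    (C C' : Matrix κ ι R) (D D' : Matrix κ κ R) :
    Matrix.fromBlocks A B C D - Matrix.fromBlocks A' B' C' D' =
      Matrix.fromBlocks (A - A') (B - B') (C - C') (D - D') := by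
  ext (_ | _) (_ | _) <;> rfl

theorem map_theta_zero {ι κ : Type*} : (0 : Matrix ι κ k⸨X⸩).map theta = 0 := by
  ext1 i j
  exact theta_zero

theorem map_theta_fromBlocks {ι κ : Type*} (A : Matrix ι ι k⸨X⸩) (B : Matrix ι κ k⸨X⸩)
    (C : Matrix κ ι k⸨X⸩) (D : Matrix κ κ k⸨X⸩) :
    (Matrix.fromBlocks A B C D).map theta =
      Matrix.fromBlocks (A.map theta) (B.map theta) (C.map theta) (D.map theta) :=
  Matrix.fromBlocks_map _ _ _ _ _

/-- The inductive step. The condition on `C` says that its eigenvalues lie in `intReps k`, and it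
must be passed on to `D`. -/
theorem exists_const_fromBlocks [CharZero k] {ι : Type*} [Fintype ι] [DecidableEq ι]
    {C : Matrix ι ι k} (hC : ∀ c ∉ intReps k, IsUnit (C - Matrix.scalar ι c))
    {B : Matrix ι ι k⸨X⸩} (h : GLGauge (C.map (HahnSeries.C : k →+* k⸨X⸩)) B)
    (r : Matrix Unit ι k⸨X⸩) (l : k) :
    ∃ D : Matrix (ι ⊕ Unit) (ι ⊕ Unit) k,
      (∀ c ∉ intReps k, IsUnit (D - Matrix.scalar _ c)) ∧
      GLGauge (D.map (HahnSeries.C : k →+* k⸨X⸩))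
        (Matrix.fromBlocks B 0 r (Matrix.scalar Unit (HahnSeries.C l))) := by
  obtain ⟨g, ug, hg⟩ := h
  obtain ⟨t, ht⟩ := exists_sub_int_mem_intReps l
  set C' := C.map (HahnSeries.C : k →+* k⸨X⸩)
  -- Make the large block constant.
  have e1 : GLGauge (Matrix.fromBlocks C' 0 (r * g) (Matrix.scalar Unit (HahnSeries.C l)))
      (Matrix.fromBlocks B 0 r (Matrix.scalar Unit (HahnSeries.C l))) := by
    refine ⟨Matrix.fromBlocks g 0 0 1, ?_, ?_⟩
    · rw [Matrix.isUnit_iff_isUnit_det] at ug ⊢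
      simpa using ug
    · rw [map_theta_fromBlocks, hg, Matrix.fromBlocks_multiply, Matrix.fromBlocks_multiply,
        fromBlocks_sub, map_theta_zero, map_theta_zero, map_theta_one']
      simp
  -- Move `l` to its representative `l - t` with the gauge `z^t` on the last coordinate.
  have e2 : GLGauge (Matrix.fromBlocks C' 0 ((HahnSeries.single (-t) (1 : k) : k⸨X⸩) • (r * g))
      (Matrix.scalar Unit (HahnSeries.C (l - t))))
      (Matrix.fromBlocks C' 0 (r * g) (Matrix.scalar Unit (HahnSeries.C l))) := by
    refine ⟨Matrix.fromBlocks 1 0 0 (Matrix.scalar Unit (HahnSeries.single t (1 : k))), ?_, ?_⟩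
    · rw [Matrix.isUnit_iff_isUnit_det]
      simp
    · rw [map_theta_fromBlocks, Matrix.fromBlocks_multiply, Matrix.fromBlocks_multiply,
        fromBlocks_sub, map_theta_zero, map_theta_zero, map_theta_one']
      congr 1
      · simp
      · simp
      · ext1 i j
        simp [← mul_assoc]
      · ext1 i j
        simp only [Matrix.scalar_apply, Matrix.map_apply, Matrix.sub_apply, Matrix.add_apply,
          Matrix.mul_zero, Matrix.diagonal_mul_diagonal, Matrix.zero_apply,
          Matrix.diagonal_apply_eq, theta_single]
        rw [map_sub, map_intCast]
        ring
  obtain ⟨u, s, hu⟩ := exists_reduce_row hC ht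
    (fun j => ((HahnSeries.single (-t) (1 : k) : k⸨X⸩) • (r * g)) () j)
  -- A unipotent gauge leaves only the constants `s` in the row.
  have e3 : GLGauge (Matrix.fromBlocks C' 0 ((Matrix.replicateRow Unit s).map HahnSeries.C)
      (Matrix.scalar Unit (HahnSeries.C (l - t))))
      (Matrix.fromBlocks C' 0 ((HahnSeries.single (-t) (1 : k) : k⸨X⸩) • (r * g))
      (Matrix.scalar Unit (HahnSeries.C (l - t)))) := by
    refine ⟨Matrix.fromBlocks 1 0 (Matrix.replicateRow Unit u) 1, ?_, ?_⟩
    · rw [Matrix.isUnit_iff_isUnit_det]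
      simp
    · rw [map_theta_fromBlocks, Matrix.fromBlocks_multiply, Matrix.fromBlocks_multiply,
        fromBlocks_sub, map_theta_zero, map_theta_one', map_theta_one']
      congr 1
      · simp
      · simp
      · ext1 i j
        rw [Matrix.map_apply, Matrix.replicateRow_apply, hu j]
        simp only [Matrix.mul_one, Matrix.one_mul, Matrix.sub_apply, Matrix.add_apply,
          Matrix.scalar_apply, Matrix.diagonal_mul, Matrix.replicateRow_apply, Matrix.map_apply]
        rw [← Matrix.replicateRow_vecMul]
        simp only [Matrix.replicateRow_apply]
        ring
      · simp
  refine ⟨Matrix.fromBlocks C 0 (Matrix.replicateRow Unit s) (Matrix.scalar Unit (l - t)), ?_, ?_⟩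
  · intro c hc
    have e : Matrix.scalar (ι ⊕ Unit) c =
        Matrix.fromBlocks (Matrix.scalar ι c) 0 0 (Matrix.scalar Unit c) := by
      simp [Matrix.fromBlocks_diagonal]
    rw [e, fromBlocks_sub, Matrix.isUnit_iff_isUnit_det, sub_zero,
      Matrix.det_fromBlocks_zero₁₂]
    refine IsUnit.mul ((Matrix.isUnit_iff_isUnit_det _).1 (hC c hc)) ?_
    rw [← map_sub, isUnit_iff_ne_zero]
    have : l - t ≠ c := fun h => hc (h ▸ ht)
    simpa [sub_eq_zero] using this
  · have e : (Matrix.fromBlocks C 0 (Matrix.replicateRow Unit s) (Matrix.scalar Unit (l - t))).map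
        (HahnSeries.C : k →+* k⸨X⸩) = Matrix.fromBlocks C' 0
          ((Matrix.replicateRow Unit s).map HahnSeries.C)
          (Matrix.scalar Unit (HahnSeries.C (l - t))) := by
      rw [Matrix.fromBlocks_map]
      congr 1
      · ext1 i j
        simp
    rw [e]
    exact (e3.trans e2).trans e1

/-- A formal eigenvector splits off a block of size one. -/
theorem exists_split_block [IsAlgClosed k] [CharZero k] {n : ℕ}
    (B : Matrix (Fin (n + 1)) (Fin (n + 1)) k⟦X⟧) :
    ∃ (e : Fin (n + 1) ≃ Fin n ⊕ Unit) (B' : Matrix (Fin n) (Fin n) k⟦X⟧)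
      (r : Matrix Unit (Fin n) k⸨X⸩) (l : k),
      GLGauge ((Matrix.fromBlocks (B'.map (HahnSeries.ofPowerSeries ℤ k)) 0 r
        (Matrix.scalar Unit (HahnSeries.C l))).submatrix e e)
        (B.map (HahnSeries.ofPowerSeries ℤ k)) := by
  obtain ⟨l, v, ⟨i₀, hi₀⟩, hv⟩ := exists_formal_eigenvector B
  -- Expanding the determinant gives `v i₀`, a unit of `k⟦X⟧`, so `h` is invertible over power
  -- series and the new matrix `A` stays of the first kind.
  set h : Matrix (Fin (n + 1)) (Fin (n + 1)) k⟦X⟧ :=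
    (1 : Matrix (Fin (n + 1)) (Fin (n + 1)) k⟦X⟧).updateCol i₀ v
  have hdet : IsUnit h.det := by
    have : h.det = v i₀ := by
      rw [← Matrix.cramer_apply, Matrix.cramer_one]
      rfl
    rw [this]
    exact PowerSeries.isUnit_iff_constantCoeff.2 (isUnit_iff_ne_zero.2 hi₀)
  set φ := HahnSeries.ofPowerSeries ℤ k
  set A : Matrix (Fin (n + 1)) (Fin (n + 1)) k⟦X⟧ := h⁻¹ * (B * h - h.map thetaPS)
  have hA : h.map thetaPS = B * h - h * A := by
    rw [Matrix.mul_nonsing_inv_cancel_left _ _ hdet, sub_sub_cancel]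
  -- `h` sends the basis vector `e_{i₀}` to `v`, and `B v - z∂_z v = l v`; hence `A e_{i₀} = l
  -- e_{i₀}`.
  have hcol : ∀ i, A i i₀ = if i = i₀ then PowerSeries.C l else 0 := by
    have h1 : (B * h - h.map thetaPS).col i₀ = PowerSeries.C l • v := by
      ext1 i
      have : (B * h) i i₀ = B.mulVec v i := by
        simp [Matrix.mul_apply, Matrix.mulVec, dotProduct, h]
      rw [Matrix.col_apply, Matrix.sub_apply, this, Matrix.map_apply,
        show h i i₀ = v i from Matrix.updateCol_self, hv]
      simp
    have h2 : h.mulVec (Pi.single i₀ 1) = v := by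
      ext1 i
      simp [h]
    have h3 : A.mulVec (Pi.single i₀ 1) = PowerSeries.C l • Pi.single i₀ 1 := by
      rw [← Matrix.mulVec_mulVec, Matrix.mulVec_single_one, h1, ← h2, Matrix.mulVec_smul,
        Matrix.mulVec_mulVec, Matrix.nonsing_inv_mul _ hdet, Matrix.one_mulVec]
    intro i
    have := congrFun h3 i
    rw [Matrix.mulVec_single_one] at this
    simpa [Pi.single_apply] using this
  have hG : GLGauge (A.map φ) (B.map φ) := by
    refine ⟨h.map φ, ?_, ?_⟩
    · rw [← RingHom.mapMatrix_apply]
      exact ((Matrix.isUnit_iff_isUnit_det _).2 hdet).map _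
    · have e : (h.map φ).map theta = (h.map thetaPS).map φ := by
        ext1 i j
        exact theta_ofPowerSeries _
      rw [e, hA, Matrix.map_sub _ (map_sub φ), Matrix.map_mul, Matrix.map_mul]
  let e : Fin (n + 1) ≃ Fin n ⊕ Unit :=
    (finSuccEquiv' i₀).trans (Equiv.optionEquivSumPUnit (Fin n))
  have hei : e i₀ = Sum.inr () := by simp [e]
  have he₁ : ∀ j : Fin n, e.symm (Sum.inl j) ≠ i₀ := fun j hj => by
    have := congrArg e hj
    simp [hei] at this
  have he₂ : e.symm (Sum.inr ()) = i₀ := by rw [← hei, e.symm_apply_apply]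
  refine ⟨e, Matrix.of fun i j => A (e.symm (Sum.inl i)) (e.symm (Sum.inl j)),
    Matrix.of fun _ j => φ (A i₀ (e.symm (Sum.inl j))), l, ?_⟩
  have hblock : (A.map φ) = (Matrix.fromBlocks
      ((Matrix.of fun i j => A (e.symm (Sum.inl i)) (e.symm (Sum.inl j))).map φ) 0
      (Matrix.of fun _ j => φ (A i₀ (e.symm (Sum.inl j))))
      (Matrix.scalar Unit (HahnSeries.C l))).submatrix e e := by
    ext1 i j
    obtain ⟨i, rfl⟩ := e.symm.surjective i
    obtain ⟨j, rfl⟩ := e.symm.surjective j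
    rw [Matrix.submatrix_apply, e.apply_symm_apply, e.apply_symm_apply]
    rcases i with i | ⟨⟩ <;> rcases j with j | ⟨⟩
    · simp
    · simp [he₂, hcol, he₁]
    · simp [he₂]
    · simp [he₂, hcol, φ]
  rw [← hblock]
  exact hG

/-- Every connection of the first kind is gauge equivalent to a constant one. -/
theorem exists_const_glGauge [IsAlgClosed k] [CharZero k] {n : ℕ}
    (B : Matrix (Fin n) (Fin n) k⟦X⟧) :
    ∃ C : Matrix (Fin n) (Fin n) k, (∀ c ∉ intReps k, IsUnit (C - Matrix.scalar _ c)) ∧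
      GLGauge (C.map (HahnSeries.C : k →+* k⸨X⸩)) (B.map (HahnSeries.ofPowerSeries ℤ k)) := by
  induction n with
  | zero => exact ⟨0, fun c _ => isUnit_of_subsingleton _, by
      rw [Subsingleton.elim ((0 : Matrix (Fin 0) (Fin 0) k).map _) (B.map _)]
      exact GLGauge.refl _⟩
  | succ n ih =>
    obtain ⟨e, B', r, l, h⟩ := exists_split_block B
    obtain ⟨C', hC', hG⟩ := ih B'
    obtain ⟨D, hD, hDG⟩ := exists_const_fromBlocks hC' hG r l
    refine ⟨D.submatrix e e, fun c hc => ?_, ?_⟩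
    · have : D.submatrix e e - Matrix.scalar _ c = (D - Matrix.scalar _ c).submatrix e e := by
        rw [Matrix.submatrix_sub]
        simp [Matrix.submatrix_diagonal_equiv, Function.comp_def]
      rw [this]
      exact (Matrix.isUnit_submatrix_equiv e e).2 (hD c hc)
    · exact (hDG.submatrix e).trans h

end Field

/-! ### Jordan normal form from the structure of torsion `k[X]`-modules. -/

section JordanForm

open Polynomial

universe u

variable {k : Type u} [Field k]

/-- The quotient `k[X] / (X - x) ^ e` has a basis on which `X` acts by a Jordan block. -/
theorem exists_basis_quotient (x : k) (e : ℕ) :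
    ∃ b : Module.Basis (Fin e) k (k[X] ⧸ Ideal.span {(X - C x) ^ e}), ∀ j : Fin e,
      (X - C x : k[X]) • b j =
        if h : 0 < (j : ℕ) then b ⟨j - 1, by omega⟩ else 0 := by
  set q : k[X] := (X - C x) ^ e
  have hq : q.Monic := (monic_X_sub_C x).pow e
  -- The powers are listed in decreasing order so that `X - x` lowers the index, which puts the ones
  -- on the superdiagonal.
  let w : Fin e → k[X] ⧸ Ideal.span {q} := fun j =>
    Ideal.Quotient.mk _ ((X - C x) ^ (e - 1 - (j : ℕ)))
  have hw : LinearIndependent k w := by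
    rw [Fintype.linearIndependent_iff]
    intro c hc
    have h1 : Ideal.Quotient.mk (Ideal.span {q})
        (∑ j : Fin e, C (c j) * (X - C x) ^ (e - 1 - (j : ℕ))) = 0 := by
      rw [map_sum, ← hc]
      refine Finset.sum_congr rfl fun j _ => ?_
      rw [← smul_eq_C_mul]
      rfl
    rw [Ideal.Quotient.eq_zero_iff_dvd] at h1
    -- Translating by `x` turns divisibility by `(X - x)^e` into vanishing of the coefficients below
    -- degree `e`; degree `e - 1 - j` reads off `c j`.
    have h2 := map_dvd (taylorAlgHom x) h1
    simp only [q, map_sum, map_mul, map_pow, map_sub, taylorAlgHom_apply, taylor_X, taylor_C,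
      add_sub_cancel_right] at h2
    rw [X_pow_dvd_iff] at h2
    intro j
    have h3 := h2 (e - 1 - j) (by omega)
    simp only [finsetSum_coeff, coeff_C_mul, coeff_X_pow] at h3
    rw [Finset.sum_eq_single j] at h3
    · simpa using h3
    · intro i _ hij
      rw [if_neg, mul_zero]
      have : (i : ℕ) ≠ j := fun h => hij (Fin.ext h)
      omega
    · simp
  have hcard : Fintype.card (Fin e) = Module.finrank k (k[X] ⧸ Ideal.span {q}) := by
    rw [finrank_quotient_span_eq_natDegree, Fintype.card_fin, natDegree_pow, natDegree_X_sub_C,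
      mul_one]
  rcases Nat.eq_zero_or_pos e with rfl | he
  · have : Subsingleton (k[X] ⧸ Ideal.span {q}) := by
      rw [Ideal.Quotient.subsingleton_iff]
      simp [q]
    exact ⟨Module.Basis.empty _, fun j => j.elim0⟩
  · have : Nonempty (Fin e) := ⟨⟨0, he⟩⟩
    refine ⟨basisOfLinearIndependentOfCardEqFinrank hw hcard, fun j => ?_⟩
    simp only [coe_basisOfLinearIndependentOfCardEqFinrank]
    have hs : (X - C x : k[X]) • w j =
        Ideal.Quotient.mk _ ((X - C x) * (X - C x) ^ (e - 1 - (j : ℕ))) := rfl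
    rw [hs, ← pow_succ']
    split_ifs with hj
    · simp only [w]
      congr 2
      omega
    · rw [show e - 1 - (j : ℕ) + 1 = e by omega, Ideal.Quotient.eq_zero_iff_dvd]

theorem exists_span_pow_eq [IsAlgClosed k] {p : k[X]} (hp : Irreducible p) (e : ℕ) :
    ∃ x : k, (k[X] ∙ p ^ e) = Ideal.span {(X - C x) ^ e} := by
  obtain ⟨x, hx⟩ := IsAlgClosed.exists_root p (degree_pos_of_irreducible hp).ne'
  refine ⟨x, Ideal.span_singleton_eq_span_singleton.2 (Associated.pow_pow ?_)⟩
  exact ((irreducible_X_sub_C x).associated_of_dvd hp (dvd_iff_isRoot.2 hx)).symm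

theorem dfinsupp_basis_apply {ι : Type*} [DecidableEq ι] {M : ι → Type*}
    [∀ i, AddCommGroup (M i)] [∀ i, Module k (M i)] {η : ι → Type*}
    (b : ∀ i, Module.Basis (η i) k (M i)) (i : ι) (j : η i) :
    DFinsupp.basis b ⟨i, j⟩ = DFinsupp.single i (b i j) := by
  simp [DFinsupp.basis, Module.Basis.coe_ofRepr]

/-- An endomorphism of a finite-dimensional space has a Jordan basis. -/
theorem exists_jordan_basis [IsAlgClosed k] {V : Type*} [AddCommGroup V] [Module k V]
    [Module.Finite k V] (f : Module.End k V) :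
    ∃ (ι : Type u) (_ : Fintype ι) (x : ι → k) (a : ι → ℕ)
      (b : Module.Basis (Σ i, Fin (a i)) k V), ∀ i (j : Fin (a i)),
      f (b ⟨i, j⟩) = x i • b ⟨i, j⟩ +
        if h : 0 < (j : ℕ) then b ⟨i, ⟨j - 1, by omega⟩⟩ else 0 := by
  classical
  obtain ⟨ι, _, p, hp, a, ⟨E⟩⟩ := Module.equiv_directSum_of_isTorsion
    (R := k[X]) (M := Module.AEval' f) (Module.AEval.isTorsion_of_finiteDimensional k V f)
  choose x hx using fun i => exists_span_pow_eq (hp i) (a i)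
  have hb : ∀ i, ∃ b : Module.Basis (Fin (a i)) k (k[X] ⧸ (k[X] ∙ p i ^ a i)), ∀ j,
      (X : k[X]) • b j = (C (x i) : k[X]) • b j +
        if h : 0 < (j : ℕ) then b ⟨j - 1, by omega⟩ else 0 := fun i => by
    rw [hx i]
    obtain ⟨b, hb⟩ := exists_basis_quotient (x i) (a i)
    exact ⟨b, fun j => by rw [← hb j, sub_smul, add_sub_cancel]⟩
  choose b hb using hb
  let F : V ≃ₗ[k] DirectSum ι fun i => k[X] ⧸ (k[X] ∙ p i ^ a i) :=
    (Module.AEval'.of f).trans (E.restrictScalars k)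
  have hF : ∀ v, F (f v) = (X : k[X]) • F v := fun v => by
    change E (Module.AEval'.of f (f v)) = (X : k[X]) • E (Module.AEval'.of f v)
    rw [← Module.AEval'.X_smul_of, map_smul]
  let bb : Module.Basis (Σ i, Fin (a i)) k (DirectSum ι fun i => k[X] ⧸ (k[X] ∙ p i ^ a i)) :=
    DFinsupp.basis b
  have hbb : ∀ i j, bb ⟨i, j⟩ = DirectSum.lof k[X] ι (fun i => k[X] ⧸ (k[X] ∙ p i ^ a i)) i (b i j) :=
    fun i j => dfinsupp_basis_apply b i j
  refine ⟨ι, inferInstance, x, a, bb.map F.symm, fun i j => F.injective ?_⟩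
  rw [hF, map_add, map_smul, Module.Basis.map_apply, F.apply_symm_apply, hbb]
  have h1 := congrArg (DirectSum.lof k[X] ι (fun i => k[X] ⧸ (k[X] ∙ p i ^ a i)) i) (hb i j)
  rw [map_smul, map_add, map_smul] at h1
  rw [h1]
  congr 1
  · exact (algebraMap_smul k[X] (x i) _)
  · split_ifs with h
    · rw [Module.Basis.map_apply, F.apply_symm_apply, hbb]
    · rw [map_zero, map_zero]

/-- The identification of the positions inside the blocks with the matrix indices. -/
def JordanData.equiv {n : ℕ} (D : JordanData n k) : (Σ i : Fin D.r, Fin (D.a i)) ≃ Fin n :=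
  finSigmaFinEquiv.trans (finCongr D.sum_a)

theorem JordanData.toMatrix_apply {n : ℕ} (D : JordanData n k) (p q : Σ i : Fin D.r, Fin (D.a i)) :
    D.toMatrix (D.equiv p) (D.equiv q) = if p.1 = q.1 then
      (if (p.2 : ℕ) = q.2 then D.x q.1 else if (p.2 : ℕ) + 1 = q.2 then 1 else 0) else 0 := by
  obtain ⟨i, p⟩ := p
  obtain ⟨j, q⟩ := q
  have : D.toMatrix (D.equiv ⟨i, p⟩) (D.equiv ⟨j, q⟩) =
      Matrix.blockDiagonal' (fun i => jordanBlock (D.x i) (D.a i)) ⟨i, p⟩ ⟨j, q⟩ := by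
    simp [JordanData.toMatrix, JordanData.equiv]
  rw [this]
  by_cases h : i = j
  · subst h
    rw [Matrix.blockDiagonal'_apply_eq]
    simp [jordanBlock, Fin.ext_iff]
  · rw [Matrix.blockDiagonal'_apply_ne _ _ _ h, if_neg h]

theorem sum_mul_jordanBlock {a : ℕ} (f : Fin a → k) (q : Fin a) (c : k) :
    (∑ p : Fin a, f p * if (p : ℕ) = q then c else if (p : ℕ) + 1 = q then 1 else 0) =
      f q * c + if h : 0 < (q : ℕ) then f ⟨q - 1, by omega⟩ else 0 := by
  have h (p : Fin a) : (f p * if (p : ℕ) = q then c else if (p : ℕ) + 1 = q then 1 else 0) =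
      (if p = q then f p * c else 0) + if (p : ℕ) + 1 = q then f p else 0 := by
    by_cases h : p = q
    · subst h
      simp
    · simp [h, Fin.ext_iff.not.1 h]
  simp only [h, Finset.sum_add_distrib, Finset.sum_ite_eq', Finset.mem_univ, if_true]
  congr 1
  split_ifs with hq
  · rw [Finset.sum_eq_single ⟨q - 1, by omega⟩]
    · exact if_pos (Nat.sub_add_cancel hq)
    · intro p _ hp
      refine if_neg fun h => hp (Fin.ext ?_)
      simp only
      omega
    · simp
  · exact Finset.sum_eq_zero fun p _ => if_neg (by omega)

/-- Existence of the Jordan normal form. -/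
theorem exists_jordanData [IsAlgClosed k] {n : ℕ} (M : Matrix (Fin n) (Fin n) k) :
    ∃ (D : JordanData n k) (P : Matrix (Fin n) (Fin n) k), IsUnit P ∧
      P * D.toMatrix = M * P := by
  classical
  obtain ⟨ι, _, x, a, b, hb⟩ := exists_jordan_basis (Matrix.toLin' M)
  -- The structure theorem may produce zero summands with exponent 0; `JordanData` excludes them.
  let S := {i : ι // 0 < a i}
  let s : S ≃ Fin (Fintype.card S) := Fintype.equivFin S
  let e₀ : (Σ i : Fin (Fintype.card S), Fin (a (s.symm i).1)) ≃ Σ i, Fin (a i) :=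
    Equiv.ofBijective (fun p => ⟨(s.symm p.1).1, p.2⟩) (by
      constructor
      · rintro ⟨i, p⟩ ⟨j, q⟩ h
        obtain ⟨i, rfl⟩ := s.surjective i
        obtain ⟨j, rfl⟩ := s.surjective j
        have h1 := (Sigma.mk.inj_iff.1 h).1
        rw [s.symm_apply_apply, s.symm_apply_apply] at h1
        obtain rfl := Subtype.ext h1
        simpa using h
      · rintro ⟨i, p⟩
        have hi : 0 < a i := p.pos
        obtain ⟨j, hj⟩ := s.symm.surjective ⟨i, hi⟩
        have hj' : (s.symm j).1 = i := congrArg Subtype.val hj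
        subst hj'
        exact ⟨⟨j, p⟩, rfl⟩)
  let D : JordanData n k :=
    { r := Fintype.card S
      x := fun i => x (s.symm i).1
      a := fun i => a (s.symm i).1
      a_pos := fun i => (s.symm i).2
      sum_a := by
        have h1 := Fintype.card_congr e₀
        have h2 := Module.finrank_eq_card_basis b
        rw [Module.finrank_fin_fun] at h2
        rw [h2, ← h1]
        simp }
  let e : (Σ i : Fin D.r, Fin (D.a i)) ≃ Fin n := D.equiv
  let b' : Module.Basis (Σ i : Fin D.r, Fin (D.a i)) k (Fin n → k) := b.reindex e₀.symm
  let c : Module.Basis (Fin n) k (Fin n → k) := b'.reindex e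
  have hc : ∀ p, c (e p) = b (e₀ p) := fun p => by simp [c, b']
  refine ⟨D, (Pi.basisFun k (Fin n)).toMatrix c, ?_, ?_⟩
  · exact IsUnit.of_mul_eq_one _ ((Pi.basisFun k (Fin n)).toMatrix_mul_toMatrix_flip c)
  · ext i j
    obtain ⟨⟨j, q⟩, rfl⟩ := e.surjective j
    have hl : (M * (Pi.basisFun k (Fin n)).toMatrix c) i (e ⟨j, q⟩) =
        Matrix.toLin' M (c (e ⟨j, q⟩)) i := by
      simp [Matrix.mul_apply, Matrix.mulVec, dotProduct, Module.Basis.toMatrix_apply]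
    rw [hl, hc]
    rw [show e₀ ⟨j, q⟩ = ⟨(s.symm j).1, q⟩ from rfl, hb, Matrix.mul_apply,
      ← e.sum_comp, Fintype.sum_sigma, Finset.sum_eq_single j]
    · have hP : ∀ p, (Pi.basisFun k (Fin n)).toMatrix c i (e p) = b (e₀ p) i := fun p => by
        rw [Module.Basis.toMatrix_apply, Pi.basisFun_repr, hc]
      simp only [hP, e, JordanData.toMatrix_apply, if_true]
      rw [sum_mul_jordanBlock (fun p => b (e₀ ⟨j, p⟩) i) q]
      change _ = x (s.symm j).1 * b ⟨(s.symm j).1, q⟩ i + _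
      rw [mul_comm]
      congr 1
      split_ifs <;> rfl
    · intro i' _ hi'
      refine Finset.sum_eq_zero fun p _ => ?_
      rw [JordanData.toMatrix_apply, if_neg hi', mul_zero]
    · simp

end JordanForm

/-! ### Rational eigenvalue shifts, surjectivity, and the "if" direction. -/

/-- Change the eigenvalues of the Jordan blocks. -/
def JordanData.withX (D : JordanData n k) (y : Fin D.r → k) : JordanData n k :=
  { D with x := y }

theorem JordanData.toMatrix_withX (D : JordanData n k) (y : Fin D.r → k) :
    (D.withX y).toMatrix = D.toMatrix +
      Matrix.diagonal fun i => y (D.equiv.symm i).1 - D.x (D.equiv.symm i).1 := by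
  ext i j
  obtain ⟨i, rfl⟩ := D.equiv.surjective i
  obtain ⟨j, rfl⟩ := D.equiv.surjective j
  have h := (D.withX y).toMatrix_apply i j
  change (D.withX y).toMatrix (D.equiv i) (D.equiv j) = _ at h
  rw [h, Matrix.add_apply, D.toMatrix_apply]
  obtain ⟨b, p⟩ := i
  obtain ⟨c, q⟩ := j
  by_cases hb : b = c
  · subst hb
    by_cases hp : p = q
    · subst hp
      simp [JordanData.withX]
    · have hp' : (p : ℕ) ≠ q := fun h => hp (Fin.ext h)
      simp [hp, hp']
      exact fun h => absurd rfl h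
  · simp [hb]
    exact fun h => absurd h hb

theorem JordanData.toMatrix_apply_eq_zero (D : JordanData n k) {i j : Fin n}
    (h : (D.equiv.symm i).1 ≠ (D.equiv.symm j).1) : D.toMatrix i j = 0 := by
  have := D.toMatrix_apply (D.equiv.symm i) (D.equiv.symm j)
  rwa [D.equiv.apply_symm_apply, D.equiv.apply_symm_apply, if_neg h] at this

/-- The exponents are constant on each block and the matrix has no entries between blocks, so the
twist commutes with it. -/
theorem GLGauge.pow_twist (D : JordanData n k) (m : k⸨X⸩) (d : Fin D.r → ℤ) :
    GLGauge (m • D.toMatrix.map (HahnSeries.C : k →+* k⸨X⸩))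
      (m • D.toMatrix.map (HahnSeries.C : k →+* k⸨X⸩) +
        Matrix.diagonal fun i => (d (D.equiv.symm i).1 : k⸨X⸩)) := by
  refine GLGauge.twist (fun i => d (D.equiv.symm i).1) fun i j hij => ?_
  by_contra h
  refine hij ?_
  rw [Matrix.smul_apply, Matrix.map_apply, D.toMatrix_apply_eq_zero fun h' => h (by rw [h']),
    map_zero, smul_zero]

/-- Gauge transformation changing the eigenvalues by rational numbers, after pull-back. -/
theorem GLGauge.withX [CharZero k] (D : JordanData n k) (y : Fin D.r → k) (m : ℕ+)
    (d : Fin D.r → ℤ) (h : ∀ b, (m : k) * (y b - D.x b) = d b) :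
    GLGauge ((m : k⸨X⸩) • D.toMatrix.map (HahnSeries.C : k →+* k⸨X⸩))
      ((m : k⸨X⸩) • (D.withX y).toMatrix.map (HahnSeries.C : k →+* k⸨X⸩)) := by
  convert GLGauge.pow_twist D (m : k⸨X⸩) d using 1
  rw [D.toMatrix_withX, Matrix.map_add _ (map_add HahnSeries.C), smul_add]
  congr 1
  ext1 i j
  by_cases hij : i = j
  · subst hij
    have := congrArg (HahnSeries.C : k →+* k⸨X⸩) (h (D.equiv.symm i).1)
    simpa only [map_mul, map_natCast, map_intCast, Matrix.smul_apply, Matrix.map_apply,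
      Matrix.diagonal_apply_eq, smul_eq_mul] using this
  · simp [Matrix.diagonal_apply_ne _ hij]

theorem iota_C (m : ℕ+) (c : k) : iota m (HahnSeries.C c) = HahnSeries.C c := by
  ext i
  by_cases hi : (m : ℤ) ∣ i
  · obtain ⟨j, rfl⟩ := hi
    rw [iota_coeff_mul, HahnSeries.C_apply, HahnSeries.coeff_single, HahnSeries.coeff_single]
    simp
  · rw [iota_coeff_of_not_dvd _ _ _ hi, HahnSeries.C_apply, HahnSeries.coeff_single_of_ne]
    rintro rfl
    exact hi (dvd_zero _)

theorem pullback_standard (m : ℕ+) (X : LieAlgebra.SpecialLinear.sl (Fin n) k) :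
    (pullback m (standard X)).coeff.1 = (m : k⸨X⸩) • X.1.map (HahnSeries.C : k →+* k⸨X⸩) := by
  ext1 i j
  change (m : k⸨X⸩) * iota m (HahnSeries.C (X.1 i j)) = (m : k⸨X⸩) * HahnSeries.C (X.1 i j)
  rw [iota_C]

/-- The constant Jordan matrix need not have trace zero, but its trace is an integer `-t`. Adding
`t/n` to every eigenvalue corrects this, and pull-back along `z ↦ z^n` turns the shift into the
integer `t`. -/
theorem exists_jordan_related [IsAlgClosed k] [CharZero k] {A : SLConnection n k}
    (hA : IsRegular A) : ∃ X : JordanSl n k, Related (standard X.1) A := by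
  obtain ⟨B, hB, hAB⟩ := hA
  rcases Nat.eq_zero_or_pos n with rfl | hn
  · obtain ⟨D, -⟩ := exists_jordanData (0 : Matrix (Fin 0) (Fin 0) k)
    refine ⟨⟨⟨D.toMatrix, by simp [mem_sl_iff, Matrix.trace]⟩, D, rfl⟩, 1, ?_⟩
    rw [SLConnection.ext (Subtype.ext (Subsingleton.elim (pullback 1 (standard _)).coeff.1
      (pullback 1 A).coeff.1))]
    exact GaugeEquiv.refl _
  choose f hf using hB
  have hBf : B.coeff.1 = (Matrix.of f).map (HahnSeries.ofPowerSeries ℤ k) := by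
    ext1 i j
    exact hf i j
  obtain ⟨C, -, hC⟩ := exists_const_glGauge (Matrix.of f)
  rw [← hBf] at hC
  obtain ⟨D, P, hP, hPD⟩ := exists_jordanData C
  have hD : GLGauge (D.toMatrix.map (HahnSeries.C : k →+* k⸨X⸩)) B.coeff.1 :=
    (GLGauge.of_const hP hPD).trans hC
  have htr : (D.toMatrix.map (HahnSeries.C : k →+* k⸨X⸩)).trace =
      HahnSeries.C D.toMatrix.trace :=
    (AddMonoidHom.map_trace (HahnSeries.C : k →+* k⸨X⸩) D.toMatrix).symm
  -- The determinant of the gauge is a nonzero eigenvector of `z∂_z` with eigenvalue minus this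
  -- trace.
  obtain ⟨t, ht⟩ : ∃ t : ℤ, -D.toMatrix.trace = t := by
    obtain ⟨g, ug, hg⟩ := hD
    rw [Matrix.isUnit_iff_isUnit_det] at ug
    refine exists_int_of_theta_eq ug.ne_zero ?_
    rw [theta_det hg, (mem_sl_iff _).1 B.coeff.2, htr, zero_sub, map_neg]
  have hn0 : (n : k) ≠ 0 := by exact_mod_cast hn.ne'
  let y : Fin D.r → k := fun b => D.x b + t / n
  have hy : (D.withX y).toMatrix.trace = 0 := by
    rw [D.toMatrix_withX, Matrix.trace_add, Matrix.trace_diagonal]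
    simp only [y, add_sub_cancel_left, Finset.sum_const, Finset.card_univ, Fintype.card_fin,
      nsmul_eq_mul]
    rw [mul_div_cancel₀ _ hn0, ← ht, add_neg_cancel]
  let m : ℕ+ := ⟨n, hn⟩
  let X : JordanSl n k := ⟨⟨(D.withX y).toMatrix, hy⟩, _, rfl⟩
  refine ⟨X, m, GaugeEquiv.trans ?_ (hAB.symm.pullback m)⟩
  refine GaugeEquiv.symm (GLGauge.gaugeEquiv ?_)
  have h1 : GLGauge ((m : k⸨X⸩) • D.toMatrix.map (HahnSeries.C : k →+* k⸨X⸩))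
      (pullback m (standard X.1)).coeff.1 := by
    rw [pullback_standard]
    refine GLGauge.withX D y m (fun _ => t) fun b => ?_
    simp only [y, add_sub_cancel_left]
    exact mul_div_cancel₀ _ hn0
  have h2 := hD.iota_map m
  have h3 : (D.toMatrix.map (HahnSeries.C : k →+* k⸨X⸩)).map (iota m) =
      D.toMatrix.map (HahnSeries.C : k →+* k⸨X⸩) := by
    ext1 i j
    exact iota_C _ _
  rw [h3] at h2
  exact h2.symm.trans h1

theorem jordanClass_surjective [IsAlgClosed k] [CharZero k] :
    Function.Surjective (jordanClass n k) := by
  intro q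
  induction q using Quotient.inductionOn with
  | h A =>
    obtain ⟨X, hX⟩ := exists_jordan_related A.2
    exact ⟨X, Quotient.sound hX⟩

/-- Matrices that differ by a permutation of the indices are gauge equivalent. -/
theorem GLGauge.of_submatrix {ι : Type*} [Fintype ι] [DecidableEq ι] (A : Matrix ι ι k⸨X⸩)
    (s : ι ≃ ι) : GLGauge A (A.submatrix s s) := by
  refine ⟨(1 : Matrix ι ι k⸨X⸩).submatrix s id, ?_, ?_⟩
  · refine IsUnit.of_mul_eq_one ((1 : Matrix ι ι k⸨X⸩).submatrix id s) ?_
    ext i j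
    simp [Matrix.mul_apply, Matrix.one_apply]
  · rw [← Matrix.submatrix_map, map_theta_one', Matrix.submatrix_mul_equiv]
    ext i j
    simp [Matrix.mul_apply, Matrix.one_apply]

theorem related_of_differRationally [IsAlgClosed k] [CharZero k]
    {X Y : LieAlgebra.SpecialLinear.sl (Fin n) k} (h : DifferRationally X.1 Y.1) :
    Related (standard X) (standard Y) := by
  obtain ⟨D, E, hD, hE, τ, hτ⟩ := h
  choose ha q hq using hτ
  -- A common denominator of all the eigenvalue differences.
  let m : ℕ+ := ∏ b, ⟨(q b).den, (q b).pos⟩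
  have hm : (m : ℕ) = ∏ b, (q b).den := map_prod PNat.coeMonoidHom _ _
  have hd : ∀ b, ∃ d : ℤ, (m : k) * (E.x (τ b) - D.x b) = d := fun b => by
    obtain ⟨c, hc⟩ : (q b).den ∣ (m : ℕ) := hm ▸ Finset.dvd_prod_of_mem _ (Finset.mem_univ b)
    refine ⟨-(c * (q b).num), ?_⟩
    rw [← neg_sub, hq, hc]
    have h0 : ((q b).den : k) ≠ 0 := by exact_mod_cast (q b).den_nz
    have h1 : ((q b).den : k) * (q b : k) = (q b).num := by
      rw [Rat.cast_def, mul_div_cancel₀ _ h0]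
    push_cast
    linear_combination (-c : k) * h1
  choose d hd using hd
  -- The index permutation that moves block `b` to block `τ b` and keeps positions inside blocks.
  let σ : Fin n ≃ Fin n :=
    (D.equiv.symm.trans (Equiv.sigmaCongr τ fun b => finCongr (ha b))).trans E.equiv
  have hσ : ∀ p, σ (D.equiv p) = E.equiv ⟨τ p.1, finCongr (ha p.1) p.2⟩ := fun p => by
    simp only [σ, Equiv.trans_apply, Equiv.symm_apply_apply]
    rfl
  have hDE : (D.withX fun b => E.x (τ b)).toMatrix = E.toMatrix.submatrix σ σ := by
    ext i j
    obtain ⟨i, rfl⟩ := D.equiv.surjective i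
    obtain ⟨j, rfl⟩ := D.equiv.surjective j
    rw [Matrix.submatrix_apply, hσ, hσ, E.toMatrix_apply]
    refine ((D.withX fun b => E.x (τ b)).toMatrix_apply i j).trans ?_
    simp only [JordanData.withX, finCongr_apply, Fin.val_cast, EmbeddingLike.apply_eq_iff_eq]
    rfl
  refine ⟨m, GLGauge.gaugeEquiv ?_⟩
  rw [pullback_standard, pullback_standard, ← hD, ← hE]
  refine (GLGauge.withX D _ m d hd).trans ?_
  rw [hDE]
  exact (GLGauge.of_submatrix _ σ).symm


/-! ### Kernel dimensions as gauge invariants. -/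

theorem mulVec_const_smul {ι : Type*} [Fintype ι] (A : Matrix ι ι k⸨X⸩) (c : k) (v : ι → k⸨X⸩) :
    A.mulVec (c • v) = c • A.mulVec v := by
  have h : ∀ w : ι → k⸨X⸩, c • w = (HahnSeries.C c : k⸨X⸩) • w := fun w => by
    ext1 i
    exact HahnSeries.C_mul_eq_smul.symm
  rw [h, h, Matrix.mulVec_smul]

/-- The `k`-linear operator `z∂_z - A + l` on vectors of Laurent series. -/
def connOp {ι : Type*} [Fintype ι] (A : Matrix ι ι k⸨X⸩) (l : k) :
    (ι → k⸨X⸩) →ₗ[k] (ι → k⸨X⸩) where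
  toFun v i := theta (v i) - A.mulVec v i + l • v i
  map_add' v w := by
    ext1 i
    simp only [Pi.add_apply, theta_add, Matrix.mulVec_add, smul_add]
    ring
  map_smul' c v := by
    ext1 i
    have h : theta (c • v i) = c • theta (v i) := by
      ext i
      simp [theta_coeff, mul_left_comm]
    simp only [Pi.smul_apply, RingHom.id_apply, h, mulVec_const_smul, smul_add, smul_sub,
      smul_comm l c]

theorem connOp_apply {ι : Type*} [Fintype ι] (A : Matrix ι ι k⸨X⸩) (l : k) (v : ι → k⸨X⸩)
    (i : ι) : connOp A l v i = theta (v i) - A.mulVec v i + l • v i := rfl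

/-- By the Leibniz rule, the gauge equation says exactly that `g` intertwines the two operators. -/
theorem connOp_mulVec {ι : Type*} [Fintype ι] {A B g : Matrix ι ι k⸨X⸩}
    (h : g.map theta = B * g - g * A) (l : k) (v : ι → k⸨X⸩) :
    connOp B l (g.mulVec v) = g.mulVec (connOp A l v) := by
  have h1 : ∀ i, theta (g.mulVec v i) = (g.map theta).mulVec v i +
      g.mulVec (fun j => theta (v j)) i := fun i => by
    simp only [Matrix.mulVec, dotProduct, theta_sum, theta_mul, Finset.sum_add_distrib,
      Matrix.map_apply]
  have h2 : connOp A l v = (fun j => theta (v j)) - A.mulVec v + l • v := rfl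
  ext1 i
  rw [connOp_apply, h1, h, h2, Matrix.mulVec_add, Matrix.mulVec_sub, mulVec_const_smul,
    Matrix.sub_mulVec, Matrix.mulVec_mulVec, Matrix.mulVec_mulVec]
  simp only [Pi.add_apply, Pi.sub_apply, Pi.smul_apply]
  ring

/-- Gauge equivalent connections have generalized eigenspaces of the same dimension. -/
theorem GLGauge.finrank_ker_connOp {ι : Type*} [Fintype ι] [DecidableEq ι]
    {A B : Matrix ι ι k⸨X⸩} (h : GLGauge A B) (l : k) (j : ℕ) :
    Module.finrank k (LinearMap.ker (connOp A l ^ j)) =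
      Module.finrank k (LinearMap.ker (connOp B l ^ j)) := by
  obtain ⟨g, ⟨u, rfl⟩, hg⟩ := h
  let e : (ι → k⸨X⸩) ≃ₗ[k] (ι → k⸨X⸩) :=
    { toFun := (u : Matrix ι ι k⸨X⸩).mulVec
      invFun := ((u⁻¹ : (Matrix ι ι k⸨X⸩)ˣ) : Matrix ι ι k⸨X⸩).mulVec
      map_add' := Matrix.mulVec_add _
      map_smul' := mulVec_const_smul _
      left_inv := fun v => by rw [Matrix.mulVec_mulVec, Units.inv_mul, Matrix.one_mulVec]
      right_inv := fun v => by rw [Matrix.mulVec_mulVec, Units.mul_inv, Matrix.one_mulVec] }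
  have he : ∀ v, (connOp B l ^ j) (e v) = e ((connOp A l ^ j) v) := by
    induction j with
    | zero => exact fun v => rfl
    | succ j ih =>
      intro v
      rw [pow_succ, pow_succ, Module.End.mul_apply, Module.End.mul_apply, ← ih]
      exact congrArg _ (connOp_mulVec hg l v)
  refine LinearEquiv.finrank_eq (e.ofSubmodules _ _ ?_)
  ext v
  rw [Submodule.mem_map]
  constructor
  · rintro ⟨w, hw, rfl⟩
    rw [LinearMap.mem_ker] at hw ⊢
    change (connOp B l ^ j) (e w) = 0
    rw [he, hw, map_zero]
  · intro hv
    refine ⟨e.symm v, ?_, e.apply_symm_apply v⟩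
    rw [LinearMap.mem_ker] at hv ⊢
    refine e.injective ?_
    rw [← he, e.apply_symm_apply, hv, map_zero]

namespace JordanData

variable (D : JordanData n k)

/-- The `i`-th coefficients of the `b`-th block of a vector of Laurent series, extended by zero
to a sequence. -/
def blockCoeff (v : Fin n → k⸨X⸩) (i : ℤ) (b : Fin D.r) (p : ℕ) : k :=
  if h : p < D.a b then (v (D.equiv ⟨b, ⟨p, h⟩⟩)).coeff i else 0

variable {D}

theorem blockCoeff_of_lt (v : Fin n → k⸨X⸩) (i : ℤ) (b : Fin D.r) (p : Fin (D.a b)) :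
    D.blockCoeff v i b p = (v (D.equiv ⟨b, p⟩)).coeff i :=
  dif_pos p.2

theorem blockCoeff_of_ge (v : Fin n → k⸨X⸩) (i : ℤ) (b : Fin D.r) {p : ℕ} (h : D.a b ≤ p) :
    D.blockCoeff v i b p = 0 :=
  dif_neg (not_lt.2 h)

theorem blockCoeff_zero (i : ℤ) (b : Fin D.r) (p : ℕ) : D.blockCoeff 0 i b p = 0 := by
  simp [blockCoeff]

theorem eq_zero_of_blockCoeff {v : Fin n → k⸨X⸩} (h : ∀ i b p, D.blockCoeff v i b p = 0) :
    v = 0 := by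
  ext s i
  obtain ⟨⟨b, p⟩, rfl⟩ := D.equiv.surjective s
  rw [← blockCoeff_of_lt, h]
  rfl

theorem sum_jordanBlock_mul {a : ℕ} (f : Fin a → k) (p : Fin a) (c : k) :
    (∑ q : Fin a, (if (p : ℕ) = q then c else if (p : ℕ) + 1 = q then 1 else 0) * f q) =
      c * f p + if h : (p : ℕ) + 1 < a then f ⟨p + 1, h⟩ else 0 := by
  have h (q : Fin a) : (if (p : ℕ) = q then c else if (p : ℕ) + 1 = q then 1 else 0) * f q =
      (if p = q then c * f q else 0) + if (p : ℕ) + 1 = q then f q else 0 := by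
    by_cases h : p = q
    · subst h
      simp
    · simp [h, Fin.ext_iff.not.1 h]
  simp only [h, Finset.sum_add_distrib, Finset.sum_ite_eq, Finset.mem_univ, if_true]
  congr 1
  split_ifs with hp
  · rw [Finset.sum_eq_single ⟨p + 1, hp⟩]
    · exact if_pos rfl
    · intro q _ hq
      exact if_neg fun h => hq (Fin.ext h.symm)
    · simp
  · exact Finset.sum_eq_zero fun q _ => if_neg (by omega)

variable (D) in
/-- The operator `z∂_z - m D + l` attached to Jordan data. -/
abbrev jordanOp (m l : k) : (Fin n → k⸨X⸩) →ₗ[k] (Fin n → k⸨X⸩) :=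
  connOp ((HahnSeries.C m : k⸨X⸩) • D.toMatrix.map (HahnSeries.C : k →+* k⸨X⸩)) l

/-- The operator preserves each exponent `i` and each block `b`, acting there as a scalar minus `m`
times the shift. Extension by zero covers the end of the block. -/
theorem blockCoeff_jordanOp (m l : k) (v : Fin n → k⸨X⸩) (i : ℤ) (b : Fin D.r) (p : ℕ) :
    D.blockCoeff (D.jordanOp m l v) i b p =
      (i - m * D.x b + l) * D.blockCoeff v i b p - m * D.blockCoeff v i b (p + 1) := by
  by_cases h : p < D.a b
  · obtain ⟨p, rfl⟩ : ∃ q : Fin (D.a b), (q : ℕ) = p := ⟨⟨p, h⟩, rfl⟩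
    have hA : ((D.toMatrix.map (HahnSeries.C : k →+* k⸨X⸩)).mulVec v (D.equiv ⟨b, p⟩)).coeff i =
        D.x b * D.blockCoeff v i b p + D.blockCoeff v i b (p + 1) := by
      rw [Matrix.mulVec, dotProduct, ← D.equiv.sum_comp, Fintype.sum_sigma,
        Finset.sum_eq_single b]
      · simp only [HahnSeries.coeff_sum, Matrix.map_apply, HahnSeries.C_mul_eq_smul,
          HahnSeries.coeff_smul, smul_eq_mul, toMatrix_apply, if_true]
        rw [sum_jordanBlock_mul (fun q => (v (D.equiv ⟨b, q⟩)).coeff i), blockCoeff_of_lt]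
        rfl
      · intro c _ hc
        refine Finset.sum_eq_zero fun q _ => ?_
        rw [Matrix.map_apply, toMatrix_apply, if_neg hc.symm, map_zero, zero_mul]
      · simp
    rw [blockCoeff_of_lt, connOp_apply, Matrix.smul_mulVec, HahnSeries.coeff_add,
      HahnSeries.coeff_sub, theta_coeff, Pi.smul_apply, smul_eq_mul, HahnSeries.C_mul_eq_smul,
      HahnSeries.coeff_smul, HahnSeries.coeff_smul, hA, ← blockCoeff_of_lt]
    simp only [smul_eq_mul]
    ring
  · rw [blockCoeff_of_ge _ _ _ (not_lt.1 h), blockCoeff_of_ge _ _ _ (not_lt.1 h),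
      blockCoeff_of_ge _ _ _ (by omega), mul_zero, mul_zero, sub_zero]

theorem blockCoeff_pow_of_eq (m l : k) (v : Fin n → k⸨X⸩) {i : ℤ} {b : Fin D.r}
    (h : i - m * D.x b + l = 0) (j p : ℕ) :
    D.blockCoeff ((D.jordanOp m l ^ j) v) i b p = (-m) ^ j * D.blockCoeff v i b (p + j) := by
  induction j generalizing p with
  | zero => simp
  | succ j ih =>
    rw [pow_succ', Module.End.mul_apply, blockCoeff_jordanOp, h, ih (p + 1),
      show p + 1 + j = p + (j + 1) by ring]
    ring

theorem blockCoeff_pow_eq_zero (m l : k) (v : Fin n → k⸨X⸩) {i : ℤ} {b : Fin D.r}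
    (h : ∀ p, D.blockCoeff v i b p = 0) (j p : ℕ) :
    D.blockCoeff ((D.jordanOp m l ^ j) v) i b p = 0 := by
  induction j generalizing p with
  | zero => exact h p
  | succ j ih =>
    rw [pow_succ', Module.End.mul_apply, blockCoeff_jordanOp, ih, ih, mul_zero, mul_zero, sub_zero]

/-- Where the scalar is nonzero the operator is scalar plus nilpotent, hence injective: entries
vanish by induction from the end of the block backwards. -/
theorem blockCoeff_eq_zero_of_pow {m l : k} {i : ℤ} {b : Fin D.r}
    (hc : i - m * D.x b + l ≠ 0) {j : ℕ} {v : Fin n → k⸨X⸩}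
    (h : ∀ p, D.blockCoeff ((D.jordanOp m l ^ j) v) i b p = 0) (p : ℕ) :
    D.blockCoeff v i b p = 0 := by
  induction j generalizing v p with
  | zero => exact h p
  | succ j ih =>
    have h1 : ∀ p, D.blockCoeff (D.jordanOp m l v) i b p = 0 := fun p => by
      refine ih (fun q => ?_) p
      rw [← Module.End.mul_apply, ← pow_succ]
      exact h q
    have h2 : ∀ d p, D.a b ≤ p + d → D.blockCoeff v i b p = 0 := fun d => by
      induction d with
      | zero => exact fun p hp => blockCoeff_of_ge _ _ _ hp
      | succ d ihd =>
        intro p hp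
        have h3 := h1 p
        rw [blockCoeff_jordanOp, ihd (p + 1) (by omega), mul_zero, sub_zero] at h3
        exact (mul_eq_zero.1 h3).resolve_left hc
    exact h2 (D.a b) p (by omega)

open Classical in
-- In characteristic zero each block has at most one resonant exponent `i`. There the operator is a
-- nonzero multiple of the shift, whose `j`-th power kills exactly the first `min j a_b` positions;
-- all other exponents contribute nothing.
theorem finrank_ker_jordanOp [CharZero k] {m : k} (hm : m ≠ 0) (l : k) (j : ℕ) :
    Module.finrank k (LinearMap.ker (D.jordanOp m l ^ j)) =
      ∑ b : Fin D.r, if ∃ i : ℤ, i - m * D.x b + l = 0 then min j (D.a b) else 0 := by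
  let P : Fin D.r → Prop := fun b => ∃ i : ℤ, i - m * D.x b + l = 0
  let c : {b // P b} → ℤ := fun b => b.2.choose
  have hcs : ∀ b : {b // P b}, c b - m * D.x b + l = 0 := fun b => b.2.choose_spec
  let S := Σ b : {b // P b}, Fin (min j (D.a b))
  let F : LinearMap.ker (D.jordanOp m l ^ j) →ₗ[k] (S → k) :=
    { toFun := fun v s => (v.1 (D.equiv ⟨s.1, s.2.castLE (min_le_right _ _)⟩)).coeff (c s.1)
      map_add' := fun v w => rfl
      map_smul' := fun v w => rfl }
  have hFi : Function.Injective F := by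
    rw [injective_iff_map_eq_zero]
    intro v hv
    have hker : (D.jordanOp m l ^ j) v.1 = 0 := LinearMap.mem_ker.1 v.2
    refine Subtype.ext (eq_zero_of_blockCoeff (D := D) fun i b p => ?_)
    by_cases hi : i - m * D.x b + l = 0
    · by_cases hp : p < j
      · by_cases hpa : p < D.a b
        · have h1 : c ⟨b, i, hi⟩ = i := by
            have := hcs ⟨b, i, hi⟩
            have h2 : ((c ⟨b, i, hi⟩ : ℤ) : k) = i := by linear_combination this - hi
            exact_mod_cast h2
          have h3 : (v.1 (D.equiv ⟨b, ⟨p, hpa⟩⟩)).coeff (c ⟨b, i, hi⟩) = 0 :=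
            congrFun hv ⟨⟨b, i, hi⟩, ⟨p, lt_min hp hpa⟩⟩
          have h4 := blockCoeff_of_lt v.1 i b ⟨p, hpa⟩
          rw [h1] at h3
          exact h4.trans h3
        · exact blockCoeff_of_ge _ _ _ (not_lt.1 hpa)
      · have h1 := blockCoeff_pow_of_eq m l v.1 hi j (p - j)
        rw [hker, blockCoeff_zero, Nat.sub_add_cancel (not_lt.1 hp)] at h1
        exact (mul_eq_zero.1 h1.symm).resolve_left (pow_ne_zero _ (neg_ne_zero.2 hm))
    · refine blockCoeff_eq_zero_of_pow hi (j := j) (fun p => ?_) p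
      rw [hker, blockCoeff_zero]
  have hFs : Function.Surjective F := by
    intro f
    -- Place the prescribed values as monomials at the resonant exponents, in positions below `j`.
    let w : (Σ b : Fin D.r, Fin (D.a b)) → k⸨X⸩ := fun s =>
      if h : P s.1 ∧ (s.2 : ℕ) < j then HahnSeries.single (c ⟨s.1, h.1⟩)
        (f ⟨⟨s.1, h.1⟩, ⟨s.2, lt_min h.2 s.2.2⟩⟩) else 0
    let v : Fin n → k⸨X⸩ := fun s => w (D.equiv.symm s)
    have hv : ∀ s, v (D.equiv s) = w s := fun s => by simp [v]
    have hker : (D.jordanOp m l ^ j) v = 0 := by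
      refine eq_zero_of_blockCoeff (D := D) fun i b p => ?_
      by_cases hi : i - m * D.x b + l = 0
      · rw [blockCoeff_pow_of_eq m l v hi]
        by_cases hpa : p + j < D.a b
        · rw [blockCoeff_of_lt v i b ⟨p + j, hpa⟩, hv]
          simp [w]
        · rw [blockCoeff_of_ge _ _ _ (not_lt.1 hpa), mul_zero]
      · refine blockCoeff_pow_eq_zero m l v (fun p => ?_) j p
        by_cases hpa : p < D.a b
        · rw [blockCoeff_of_lt v i b ⟨p, hpa⟩, hv]
          simp only [w]
          split_ifs with h
          · refine HahnSeries.coeff_single_of_ne ?_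
            rintro rfl
            exact hi (hcs _)
          · rfl
        · exact blockCoeff_of_ge _ _ _ (not_lt.1 hpa)
    refine ⟨⟨v, LinearMap.mem_ker.2 hker⟩, funext fun ⟨b, p⟩ => ?_⟩
    have hp : (p : ℕ) < j := lt_of_lt_of_le p.2 (min_le_left _ _)
    change (v (D.equiv ⟨b, _⟩)).coeff (c b) = _
    rw [hv]
    simp only [w]
    rw [dif_pos ⟨b.2, hp⟩]
    exact HahnSeries.coeff_single_same _ _
  rw [(LinearEquiv.ofBijective F ⟨hFi, hFs⟩).finrank_eq, Module.finrank_fintype_fun_eq_card,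
    Fintype.card_sigma]
  simp only [Fintype.card_fin]
  rw [← Finset.sum_filter]
  exact (Finset.sum_subtype _ (by simp [P]) fun b => min j (D.a b)).symm

end JordanData

/-! ### Recovering the blocks from the kernel dimensions. -/

open Classical in
theorem differRationally_of_related [CharZero k] {X Y : LieAlgebra.SpecialLinear.sl (Fin n) k}
    (hX : IsJordan X.1) (hY : IsJordan Y.1) (h : Related (standard X) (standard Y)) :
    DifferRationally X.1 Y.1 := by
  obtain ⟨D, hD⟩ := hX
  obtain ⟨E, hE⟩ := hY
  obtain ⟨m, h⟩ := h
  have hG := h.glGauge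
  rw [pullback_standard, pullback_standard, ← hD, ← hE,
    ← map_natCast (HahnSeries.C : k →+* k⸨X⸩)] at hG
  have hm : ((m : ℕ) : k) ≠ 0 := by exact_mod_cast m.ne_zero
  have hN (l : k) (j : ℕ) := hG.finrank_ker_connOp l j
  simp only [JordanData.finrank_ker_jordanOp hm] at hN
  let Q := k ⧸ (Int.castAddHom k).range
  let f (D : JordanData n k) (b : Fin D.r) : Q × ℕ :=
    (((m : k) * D.x b : k), D.a b)
  have hcl (D : JordanData n k) (b : Fin D.r) (l : k) :
      (((m : k) * D.x b : k) : Q) = (l : Q) ↔ ∃ i : ℤ, (i : k) - m * D.x b + l = 0 := by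
    rw [eq_comm, QuotientAddGroup.eq]
    constructor
    · rintro ⟨i, hi⟩
      refine ⟨i, ?_⟩
      change (i : k) = _ at hi
      rw [hi]
      ring
    · rintro ⟨i, hi⟩
      refine ⟨i, ?_⟩
      change (i : k) = _
      linear_combination hi
  -- Termwise, `2 min(s+1, a) - min(s, a) - min(s+2, a)` is 1 if `a = s + 1` and 0 otherwise. The
  -- cast to ℤ avoids truncated subtraction.
  have hcard (D : JordanData n k) (l : k) (s : ℕ) :
      (Fintype.card {b // f D b = ((l : Q), s + 1)} : ℤ) =
        2 * (∑ b, if ∃ i : ℤ, (i : k) - m * D.x b + l = 0 then min (s + 1) (D.a b) else 0 : ℕ) -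
        (∑ b, if ∃ i : ℤ, (i : k) - m * D.x b + l = 0 then min s (D.a b) else 0 : ℕ) -
        (∑ b, if ∃ i : ℤ, (i : k) - m * D.x b + l = 0 then min (s + 2) (D.a b) else 0 : ℕ) := by
    rw [Fintype.card_subtype, Finset.card_filter]
    push_cast
    rw [Finset.mul_sum, ← Finset.sum_sub_distrib, ← Finset.sum_sub_distrib]
    refine Finset.sum_congr rfl fun b _ => ?_
    simp only [f, Prod.mk.injEq, hcl]
    by_cases h : ∃ i : ℤ, (i : k) - m * D.x b + l = 0
    · simp only [h, true_and, if_true]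
      split_ifs <;> omega
    · simp [h]
  have hfib : ∀ c, Nonempty ({b // f D b = c} ≃ {b // f E b = c}) := by
    rintro ⟨q, s⟩
    obtain ⟨l, rfl⟩ := QuotientAddGroup.mk_surjective q
    rcases s with - | s
    · have h0 (D : JordanData n k) : IsEmpty {b // f D b = ((l : Q), 0)} :=
        ⟨fun b => (D.a_pos b.1).ne' (congrArg Prod.snd b.2)⟩
      have := h0 D
      have := h0 E
      exact ⟨Equiv.equivOfIsEmpty _ _⟩
    · refine Fintype.card_eq.1 ?_
      have h1 := hcard D l s
      rw [hN l (s + 1), hN l s, hN l (s + 2), ← hcard E l s] at h1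
      exact_mod_cast h1
  -- Equal fibre sizes over (class of `m x` modulo ℤ, size) glue to a bijection of blocks; dividing
  -- the integer difference by `m` gives the rational one.
  let τ : Fin D.r ≃ Fin E.r := Equiv.ofFiberEquiv fun c => (hfib c).some
  have hτ : ∀ b, f E (τ b) = f D b := Equiv.ofFiberEquiv_map _
  refine ⟨D, E, hD, hE, τ, fun b => ⟨(congrArg Prod.snd (hτ b)).symm, ?_⟩⟩
  obtain ⟨i, hi⟩ := (hcl D b (m * E.x (τ b))).1 (congrArg Prod.fst (hτ b)).symm
  refine ⟨i / m, mul_left_cancel₀ hm ?_⟩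
  push_cast
  rw [mul_div_cancel₀ _ hm]
  linear_combination -hi

end
end RegConn

theorem mainTheorem4 (n : ℕ) (k : Type*) [Field k] [IsAlgClosed k] [CharZero k] :
    Function.Surjective (RegConn.jordanClass n k) ∧
    ∀ X Y : RegConn.JordanSl n k,
      RegConn.Related (RegConn.standard X.1) (RegConn.standard Y.1) ↔
        RegConn.DifferRationally X.1.1 Y.1.1 :=
  ⟨RegConn.jordanClass_surjective, fun X Y =>
    ⟨RegConn.differRationally_of_related X.2 Y.2, RegConn.related_of_differRationally⟩⟩
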